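/- Let $0\le\nu<1$, $w=\tfrac12$ and $\mu=\tfrac{1-\nu}{2}$. For $L\ge 2$ consider diffusion-limited pair annihilation and deposition on the torus $\mathbb Z/L\mathbb Z$: the continuous-time Markov chain on $\{0,1\}^{\mathbb Z/L\mathbb Z}$ in which, for each bond $(k,k+1)$, both occupation numbers $\eta_k,\eta_{k+1}$ are flipped with rate $\mu$ (deposition events) and, independently, with rate $w(\eta_k+\eta_{k+1})$ (particle jumps). Let the activity $A(t)$ be the number of particle jumps up to time $t$, with $A(0)=0$. Then for all $s\in\mathbb R$ and every initial configuration $\eta$ with an even number of particles the limit $$K_L(s)=\lim_{t\to\infty}\frac{1}{Lt}\ln \mathbb E_{\eta}\big[e^{sA(t)}\big]$$ exists with finite expectations, does not depend on $\eta$, and is differentiable in $s$. Let $A_L(s)=K_L'(s)$ be the mean activity, and let $A^c(L)=A_L(s_c)$ be its value at the critical point $s_c=\ln(1-\mu/w)=\ln\nu$; for $\nu=0$, where $s_c=-\infty$, let $A^c(L)=\lim_{s\to-\infty}A_L(s)$ (this limit exists). For every fixed $\nu\in[0,1)$, as $L\to\infty$, $$A^c(L)=\kappa_1^\ast+\frac{\nu(1-2\nu)}{\sqrt{1-\nu^2}}\,\frac{\pi}{24L^2}+O(L^{-4}),\qquad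 \kappa_1^\ast=\frac1\pi\left(\sqrt{1-\nu^2}-\frac{1-\nu}{\nu}\arcsin\nu\right),$$ where for $\nu=0$ the constant $\kappa_1^\ast$ is understood as its limit $0$ for $\nu\to0$. -/

import Mathlib

open Filter Topology Asymptotics

noncomputable section

namespace DLPAD

/-- Configurations on the integer torus `ℤ/Lℤ`; `η k = true` means that site `k` is occupied. -/
abbrev Config (L : ℕ) : Type := ZMod L → Bool

/-- The occupation number `η_k ∈ {0, 1}` as a real number. -/
def occ {L : ℕ} (η : Config L) (k : ZMod L) : ℝ := if η k then 1 else 0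

/-- The configuration in which the occupation numbers at `k` and `k + 1` are flipped. -/
def flip {L : ℕ} (η : Config L) (k : ZMod L) : Config L :=
  fun j => if j = k ∨ j = k + 1 then !(η j) else η j

/-- The total particle number. -/
def particleNumber {L : ℕ} [NeZero L] (η : Config L) : ℕ :=
  ∑ k : ZMod L, if η k then 1 else 0

/-- State space of the joint process `(η(t), A(t))`: configuration and number of jumps so far. -/
abbrev JointState (L : ℕ) : Type := Config L × ℕ

/-- The generator of the joint process: on every bond a pair flip occurs with deposition rate `μ`,
leaving `A` unchanged, and with jump rate `w (η_k + η_{k+1})`, raising `A` by one. The first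
component alone is diffusion-limited pair annihilation and deposition. -/
def jointGenerator (w μ : ℝ) (L : ℕ) [NeZero L] (f : JointState L → ℝ) : JointState L → ℝ :=
  fun x => ∑ k : ZMod L,
    (μ * f (flip x.1 k, x.2)
      + w * (occ x.1 k + occ x.1 (k + 1)) * f (flip x.1 k, x.2 + 1)
      - (μ + w * (occ x.1 k + occ x.1 (k + 1))) * f x)

/-- The Markov semigroup `exp (t 𝓗) f = ∑ₙ tⁿ/n! 𝓗ⁿ f` of the joint process. The transition rates
are bounded, so the series converges absolutely for every bounded `f`. -/
def semigroup (w μ : ℝ) (L : ℕ) [NeZero L] (t : ℝ) (f : JointState L → ℝ) (x : JointState L) : ℝ :=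
  ∑' n : ℕ, t ^ n / (n.factorial : ℝ) * ((jointGenerator w μ L)^[n] f) x

open Classical in
/-- The probability that the joint process started in `x` is in the state `y` at time `t`. -/
def transitionProb (w μ : ℝ) (L : ℕ) [NeZero L] (t : ℝ) (x y : JointState L) : ℝ :=
  semigroup w μ L t (fun z => if z = y then 1 else 0) x

/-- The moment generating function `E_{η,0} [exp (s A(t))]` of the activity `A(t)`, for the process
started in the configuration `η` with `A(0) = 0`. -/
def activityMGF (w μ : ℝ) (L : ℕ) [NeZero L] (η : Config L) (s t : ℝ) : ℝ :=
  ∑' y : JointState L, Real.exp (s * y.2) * transitionProb w μ L t (η, 0) y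

/-- `K` is the limiting cumulant generating function of the activity per site and unit time in the
even sector: for every initial configuration with an even number of particles and all `s`, the
moment generating function of `A(t)` is finite and
`K s = lim_{t → ∞} (1 / (L t)) log E_{η,0} [exp (s A(t))]`. -/
def IsEvenCGF (w μ : ℝ) (L : ℕ) [NeZero L] (K : ℝ → ℝ) : Prop :=
  ∀ η : Config L, Even (particleNumber η) → ∀ s : ℝ,
    (∀ t : ℝ, 0 < t →
      Summable fun y : JointState L => Real.exp (s * y.2) * transitionProb w μ L t (η, 0) y) ∧
    Tendsto (fun t : ℝ => Real.log (activityMGF w μ L η s t) / (L * t)) atTop (𝓝 (K s))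

/-- The critical point `s_c = log (1 - μ/w)` (a real number for `0 < μ < w`). -/
def criticalPoint (w μ : ℝ) : ℝ := Real.log (1 - μ / w)

/-- The asymptotic critical mean activity; at `ν = 0` it is the limit as `ν → 0`, which is `0`. -/
def kappaStarOne (ν : ℝ) : ℝ :=
  if ν = 0 then 0
  else 1 / Real.pi * (Real.sqrt (1 - ν ^ 2) - (1 - ν) / ν * Real.arcsin ν)

end DLPAD

end

/-!
Weighting every jump by `exp s` turns the generator of the chain on configurations into a tilted
generator, whose semigroup evaluates the moment generating function of the activity. On the even
sector this operator has nonnegative off-diagonal rates, so a positive eigenfunction there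
identifies the exponential growth rate with its eigenvalue.

Conjugation by a power of the particle number makes the tilted generator a quadratic form in the
Majorana operators of the Jordan–Wigner transformation. In the even sector these obey antiperiodic
boundary conditions, so the momenta are the roots of `z ^ L = -1`. A Bogoliubov rotation writes the
operator as a constant minus a sum of nonnegative number operators; the constant is the sum of the
dispersion relation over the momenta. Filling the modes `z` and `z⁻¹` of the vacuum in pairs
yields a common zero `ψ` of the number operators, hence a top eigenvector. By the variational
principle `|ψ|` is one as well, and it is positive because pair flips connect the even sector.

The generating function is thus an explicit finite sum of square roots, and at the critical point
its derivative is a midpoint Riemann sum over half momenta in `[0, π]` of a function which is smooth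
up to the end points. The `1 / L ^ 2` term is the boundary correction of the midpoint rule.
-/

noncomputable section

namespace DLPAD

section MidpointRule

/-! ### The corrected midpoint rule -/

variable {f : ℝ → ℝ} {M : ℝ}

lemma abs_sub_taylor_le {n : ℕ} (hf : ContDiff ℝ (n + 1) f) {c x : ℝ}
    (hM : ∀ y ∈ Set.uIcc c x, |iteratedDeriv (n + 1) f y| ≤ M) :
    |f x - ∑ k ∈ Finset.range (n + 1), iteratedDeriv k f c / k.factorial * (x - c) ^ k|
      ≤ M * |x - c| ^ (n + 1) / (n + 1).factorial := by
  rcases eq_or_ne c x with rfl | hcx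
  · simp [Finset.sum_range_succ']
  obtain ⟨y, hy, hxy⟩ := taylor_mean_remainder_lagrange_iteratedDeriv hcx hf.contDiffOn
  have htaylor : taylorWithinEval f n (Set.uIcc c x) c x =
      ∑ k ∈ Finset.range (n + 1), iteratedDeriv k f c / k.factorial * (x - c) ^ k := by
    rw [taylor_within_apply]
    refine Finset.sum_congr rfl fun k hk => ?_
    have hkn : (k : WithTop ℕ∞) ≤ n + 1 := by
      exact_mod_cast (Finset.mem_range.mp hk).le
    rw [iteratedDerivWithin_eq_iteratedDeriv (uniqueDiffOn_uIcc hcx)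
      (hf.of_le hkn).contDiffAt Set.left_mem_uIcc, smul_eq_mul]
    ring
  rw [← htaylor, hxy, abs_div, abs_mul, abs_pow, Nat.abs_cast]
  gcongr
  exact hM y (Set.uIoo_subset_uIcc_self hy)

lemma abs_integral_sub_le_of_contDiff_four (hf : ContDiff ℝ 4 f) {c δ : ℝ} (hδ : 0 ≤ δ)
    (hM : ∀ y ∈ Set.Icc (c - δ) (c + δ), |iteratedDeriv 4 f y| ≤ M) :
    |(∫ x in (c - δ)..(c + δ), f x) - (2 * δ * f c + δ ^ 3 / 3 * iteratedDeriv 2 f c)|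
      ≤ M * δ ^ 5 / 12 := by
  set T : ℝ → ℝ := fun u => ∑ k ∈ Finset.range 4, iteratedDeriv k f c / k.factorial * u ^ k with hT
  have hTc : Continuous fun x => T (x - c) := by fun_prop
  have hTint : ∫ x in (c - δ)..(c + δ), T (x - c) =
      2 * δ * f c + δ ^ 3 / 3 * iteratedDeriv 2 f c := by
    rw [intervalIntegral.integral_comp_sub_right T c, hT, intervalIntegral.integral_finsetSum
      fun k _ => (by fun_prop : Continuous _).intervalIntegrable _ _]
    simp [Finset.sum_range_succ, integral_pow, Nat.factorial]
    ring
  have hremainder : ∀ x ∈ Set.uIoc (c - δ) (c + δ), ‖f x - T (x - c)‖ ≤ M * δ ^ 4 / 24 := by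
    intro x hx
    rw [Set.uIoc_of_le (by linarith)] at hx
    have hcx : |x - c| ≤ δ := abs_le.mpr ⟨by linarith [hx.1], by linarith [hx.2]⟩
    have hsub : Set.uIcc c x ⊆ Set.Icc (c - δ) (c + δ) :=
      Set.ordConnected_Icc.uIcc_subset ⟨by linarith, by linarith⟩ (Set.Ioc_subset_Icc_self hx)
    have hM0 : 0 ≤ M := (abs_nonneg _).trans (hM c (hsub Set.left_mem_uIcc))
    calc ‖f x - T (x - c)‖ ≤ M * |x - c| ^ 4 / 24 := by
          simpa [Nat.factorial] using abs_sub_taylor_le (n := 3) hf fun y hy => hM y (hsub hy)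
      _ ≤ M * δ ^ 4 / 24 := by gcongr
  rw [← hTint, ← intervalIntegral.integral_sub (hf.continuous.intervalIntegrable _ _)
    (hTc.intervalIntegrable _ _)]
  calc _ ≤ M * δ ^ 4 / 24 * |c + δ - (c - δ)| :=
        intervalIntegral.norm_integral_le_of_norm_le_const hremainder
    _ = M * δ ^ 5 / 12 := by rw [abs_of_nonneg (by linarith)]; ring

lemma abs_sub_sub_mul_deriv_le (hf : ContDiff ℝ 3 f) {c δ : ℝ} (hδ : 0 ≤ δ)
    (hM : ∀ y ∈ Set.Icc (c - δ) (c + δ), |iteratedDeriv 3 f y| ≤ M) :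
    |f (c + δ) - f (c - δ) - 2 * δ * deriv f c| ≤ M * δ ^ 3 / 3 := by
  have htaylor : ∀ u, |u| = δ →
      |f (c + u) - (f c + deriv f c * u + iteratedDeriv 2 f c / 2 * u ^ 2)| ≤ M * δ ^ 3 / 6 := by
    intro u hu
    have hu' := abs_le.mp hu.le
    have := abs_sub_taylor_le (n := 2) hf (c := c) (x := c + u) fun y hy => hM y <|
      Set.ordConnected_Icc.uIcc_subset ⟨by linarith, by linarith⟩
        ⟨by linarith [hu'.1], by linarith [hu'.2]⟩ hy
    simpa [Finset.sum_range_succ, Nat.factorial, hu] using this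
  have hplus := abs_le.mp (htaylor δ (abs_of_nonneg hδ))
  have hminus := abs_le.mp (htaylor (-δ) (by rw [abs_neg, abs_of_nonneg hδ]))
  rw [← sub_eq_add_neg] at hminus
  exact abs_le.mpr ⟨by linarith, by linarith⟩

/-- The error of the midpoint rule is `δ³ f'' / 3` to leading order, which the difference of `f'`
at the endpoints recovers. -/
lemma abs_integral_sub_midpoint_le (hf : ContDiff ℝ 4 f) {c δ : ℝ} (hδ : 0 ≤ δ)
    (hM : ∀ y ∈ Set.Icc (c - δ) (c + δ), |iteratedDeriv 4 f y| ≤ M) :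
    |(∫ x in (c - δ)..(c + δ), f x) - 2 * δ * f c
        - δ ^ 2 / 6 * (deriv f (c + δ) - deriv f (c - δ))| ≤ 5 / 36 * M * δ ^ 5 := by
  have hf' : ContDiff ℝ 3 (deriv f) := (contDiff_succ_iff_deriv (n := 3).mp hf).2.2
  have hint := abs_le.mp (abs_integral_sub_le_of_contDiff_four hf hδ hM)
  have hderiv := abs_sub_sub_mul_deriv_le hf' hδ fun y hy => by
    simpa only [← iteratedDeriv_succ'] using hM y hy
  have hsecond : deriv (deriv f) c = iteratedDeriv 2 f c := by simp [iteratedDeriv_succ]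
  rw [hsecond, abs_le] at hderiv
  have hδ2 : 0 ≤ δ ^ 2 / 6 := by positivity
  have hlower := mul_le_mul_of_nonneg_left hderiv.1 hδ2
  have hupper := mul_le_mul_of_nonneg_left hderiv.2 hδ2
  exact abs_le.mpr ⟨by linarith, by linarith⟩

lemma abs_midpoint_sum_sub_integral_le (hf : ContDiff ℝ 4 f) {a b : ℝ} (hab : a ≤ b)
    (hM : ∀ y ∈ Set.Icc a b, |iteratedDeriv 4 f y| ≤ M) {n : ℕ} (hn : 0 < n) :
    |(b - a) / n * ∑ j ∈ Finset.range n, f (a + (b - a) * (2 * j + 1) / (2 * n))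
        - ((∫ x in a..b, f x) - (b - a) ^ 2 / (24 * n ^ 2) * (deriv f b - deriv f a))|
      ≤ 5 / 1152 * M * (b - a) ^ 5 / n ^ 4 := by
  have : (0 : ℝ) < n := by exact_mod_cast hn
  set δ := (b - a) / (2 * n) with hδ
  have hδ0 : 0 ≤ δ := div_nonneg (sub_nonneg.mpr hab) (by positivity)
  set node : ℕ → ℝ := fun j => a + (b - a) * j / n with hnode
  set mid : ℕ → ℝ := fun j => a + (b - a) * (2 * j + 1) / (2 * n) with hmid
  have hleft : ∀ j, mid j - δ = node j := fun j => by
    simp only [hmid, hδ, hnode]; field_simp; ring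
  have hright : ∀ j, mid j + δ = node (j + 1) := fun j => by
    simp only [hmid, hδ, hnode]; push_cast; field_simp; ring
  have hnode0 : node 0 = a := by simp [hnode]
  have hnoden : node n = b := by simp only [hnode]; field_simp; ring
  have hmono : Monotone node := monotone_nat_of_le_succ fun j => by
    linarith [hleft j, hright j]
  have hstep : ∀ j ∈ Finset.range n, |(∫ x in node j..node (j + 1), f x) - 2 * δ * f (mid j)
      - δ ^ 2 / 6 * (deriv f (node (j + 1)) - deriv f (node j))| ≤ 5 / 36 * M * δ ^ 5 := by
    intro j hj
    rw [← hleft, ← hright]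
    refine abs_integral_sub_midpoint_le hf hδ0 fun y hy => hM y ?_
    rw [hleft, hright] at hy
    exact ⟨hnode0 ▸ (hmono j.zero_le).trans hy.1,
      hy.2.trans (hnoden ▸ hmono (Finset.mem_range.mp hj))⟩
  have hsum := (Finset.abs_sum_le_sum_abs _ _).trans (Finset.sum_le_sum hstep)
  rw [Finset.sum_sub_distrib, Finset.sum_sub_distrib, ← Finset.mul_sum, ← Finset.mul_sum,
    Finset.sum_range_sub (fun j => deriv f (node j)),
    intervalIntegral.sum_integral_adjacent_intervals
      fun _ _ => hf.continuous.intervalIntegrable _ _,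
    hnode0, hnoden, Finset.sum_const, Finset.card_range, nsmul_eq_mul, ← abs_neg] at hsum
  have hwidth : (b - a) / n = 2 * δ := by simp only [hδ]; field_simp
  have hcorrection : (b - a) ^ 2 / (24 * n ^ 2) = δ ^ 2 / 6 := by simp only [hδ]; field_simp; ring
  have hbound : 5 / 1152 * M * (b - a) ^ 5 / n ^ 4 = n * (5 / 36 * M * δ ^ 5) := by
    simp only [hδ]; field_simp; ring
  rw [hwidth, hcorrection, hbound]
  refine le_of_eq_of_le (congrArg abs ?_) hsum
  ring

theorem isBigO_midpoint_sum_sub_integral (hf : ContDiff ℝ 4 f) {a b : ℝ} (hab : a ≤ b) :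
    (fun n : ℕ => (b - a) / n * ∑ j ∈ Finset.range n, f (a + (b - a) * (2 * j + 1) / (2 * n))
        - ((∫ x in a..b, f x) - (b - a) ^ 2 / (24 * n ^ 2) * (deriv f b - deriv f a)))
      =O[atTop] fun n : ℕ => 1 / (n : ℝ) ^ 4 := by
  obtain ⟨M, hM⟩ := isCompact_Icc.exists_bound_of_continuousOn (s := Set.Icc a b)
    (hf.continuous_iteratedDeriv 4 le_rfl).continuousOn
  refine IsBigO.of_bound (5 / 1152 * M * (b - a) ^ 5) ?_
  filter_upwards [eventually_gt_atTop 0] with n hn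
  rw [Real.norm_eq_abs, Real.norm_of_nonneg (by positivity), mul_one_div]
  exact abs_midpoint_sum_sub_integral_le hf hab hM hn

end MidpointRule

section OperatorExponential

/-! ### Exponentials of cross-positive operators -/

variable {E I : Type*} [NormedAddCommGroup E] [NormedSpace ℝ E] {ℓ : I → E →L[ℝ] ℝ}
  {T : E →L[ℝ] E} {Λ t : ℝ} {φ f : E}

/-- `T` is cross-positive for the closed convex cone `{f | ∀ i, 0 ≤ ℓ i f}`, which may contain
lines: a multiple of the identity can be added to `T` so that the cone is preserved. For the
coordinate functionals on a finite function space these are the operators with nonnegative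
off-diagonal entries. -/
def IsCrossPositive (ℓ : I → E →L[ℝ] ℝ) (T : E →L[ℝ] E) : Prop :=
  ∃ D : ℝ, ∀ f, (∀ i, 0 ≤ ℓ i f) → ∀ i, 0 ≤ ℓ i (T f) + D * ℓ i f

lemma IsCrossPositive.apply_eq_zero (hT : IsCrossPositive ℓ T) (hf : ∀ i, ℓ i f = 0) (i : I) :
    ℓ i (T f) = 0 := by
  obtain ⟨D, hD⟩ := hT
  refine le_antisymm ?_ ?_
  · simpa [hf] using hD (-f) (fun j => by simp [hf]) i
  · simpa [hf] using hD f (fun j => (hf j).ge) i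

variable [CompleteSpace E]

lemma hasSum_exp_smul_apply (T : E →L[ℝ] E) (t : ℝ) (f : E) :
    HasSum (fun n : ℕ => (t ^ n / n.factorial) • (T ^ n) f) (NormedSpace.exp (t • T) f) := by
  have h := (ContinuousLinearMap.apply ℝ E f).hasSum
    (NormedSpace.exp_series_hasSum_exp' (𝕂 := ℝ) (t • T))
  simpa [smul_pow, smul_smul, div_eq_inv_mul] using h

lemma IsCrossPositive.exp_nonneg (hT : IsCrossPositive ℓ T) (ht : 0 ≤ t) (hf : ∀ i, 0 ≤ ℓ i f)
    (i : I) : 0 ≤ ℓ i (NormedSpace.exp (t • T) f) := by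
  obtain ⟨D, hD⟩ := hT
  set U : E →L[ℝ] E := T + D • 1 with hU
  have hpow : ∀ n j, 0 ≤ ℓ j ((U ^ n) f) := by
    intro n
    induction n with
    | zero => simpa using hf
    | succ n ih => exact fun j => by simpa [pow_succ', hU] using hD _ ih j
  have hexp : NormedSpace.exp (t • T) = Real.exp (-(t * D)) • NormedSpace.exp (t • U) := by
    have hsplit : t • T = t • U + (-(t * D)) • 1 := by rw [hU]; module
    have hscalar : NormedSpace.exp ((-(t * D)) • (1 : E →L[ℝ] E)) = Real.exp (-(t * D)) • 1 := by
      rw [← Algebra.algebraMap_eq_smul_one, ← Algebra.algebraMap_eq_smul_one,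
        Real.exp_eq_exp_ℝ, NormedSpace.algebraMap_exp_comm]
    let _ : NormedAlgebra ℚ (E →L[ℝ] E) := .restrictScalars ℚ ℝ _
    rw [hsplit, NormedSpace.exp_add_of_commute ((Commute.one_right _).smul_right _), hscalar,
      mul_smul_comm, mul_one]
  rw [hexp, smul_apply, map_smul]
  refine mul_nonneg (Real.exp_nonneg _) <|
    ((ℓ i).hasSum (hasSum_exp_smul_apply U t f)).nonneg fun n => ?_
  rw [map_smul]
  exact mul_nonneg (by positivity) (hpow n i)

lemma IsCrossPositive.exp_apply_eigenvector (hT : IsCrossPositive ℓ T)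
    (hφ : ∀ i, ℓ i (T φ) = Λ * ℓ i φ) (t : ℝ) (i : I) :
    ℓ i (NormedSpace.exp (t • T) φ) = Real.exp (Λ * t) * ℓ i φ := by
  have hpow : ∀ n j, ℓ j ((T ^ n) φ) = Λ ^ n * ℓ j φ := by
    intro n
    induction n with
    | zero => simp
    | succ n ih =>
      intro j
      have := hT.apply_eq_zero (f := (T ^ n) φ - Λ ^ n • φ) (fun k => by
        rw [map_sub, map_smul, ih, smul_eq_mul, sub_self]) j
      rw [map_sub, map_sub, map_smul, map_smul, hφ, smul_eq_mul, sub_eq_zero] at this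
      rw [pow_succ', mul_apply_eq_comp, this]
      ring
  refine ((ℓ i).hasSum (hasSum_exp_smul_apply T t φ)).unique ?_
  have := (NormedSpace.expSeries_div_hasSum_exp (Λ * t)).mul_right (ℓ i φ)
  rw [← Real.exp_eq_exp_ℝ] at this
  refine this.congr_fun fun n => ?_
  rw [map_smul, smul_eq_mul, hpow n i, mul_pow]
  ring

lemma IsCrossPositive.exists_exp_bounds [Finite I] (hT : IsCrossPositive ℓ T)
    (hpos : ∀ i, 0 < ℓ i φ) (hφ : ∀ i, ℓ i (T φ) = Λ * ℓ i φ) (hf : ∀ i, 0 < ℓ i f) (i : I) :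
    ∃ c C : ℝ, 0 < c ∧ ∀ t, 0 ≤ t → c * Real.exp (Λ * t) ≤ ℓ i (NormedSpace.exp (t • T) f) ∧
      ℓ i (NormedSpace.exp (t • T) f) ≤ C * Real.exp (Λ * t) := by
  have hratio : ∀ {g h : E}, (∀ j, 0 < ℓ j g) → (∀ j, 0 < ℓ j h) →
      ∃ C : ℝ, 0 < C ∧ ∀ j, ℓ j g ≤ C * ℓ j h := by
    intro g h hg hh
    obtain ⟨C, hC⟩ := (Set.finite_range fun j => ℓ j g / ℓ j h).bddAbove
    have hC' : ∀ j, ℓ j g / ℓ j h ≤ C := fun j => hC ⟨j, rfl⟩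
    exact ⟨C, (div_pos (hg i) (hh i)).trans_le (hC' i), fun j => (div_le_iff₀ (hh j)).mp (hC' j)⟩
  have hmono : ∀ {a b t : ℝ}, 0 ≤ t → (∀ j, 0 ≤ a * ℓ j φ + b * ℓ j f) →
      0 ≤ a * (Real.exp (Λ * t) * ℓ i φ) + b * ℓ i (NormedSpace.exp (t • T) f) := by
    intro a b t ht h
    have := hT.exp_nonneg (f := a • φ + b • f) ht (by simpa using h) i
    simpa [hT.exp_apply_eigenvector hφ] using this
  obtain ⟨C₁, hC₁, hφf⟩ := hratio hpos hf
  obtain ⟨C₂, -, hfφ⟩ := hratio hf hpos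
  refine ⟨C₁⁻¹ * ℓ i φ, C₂ * ℓ i φ, mul_pos (inv_pos.mpr hC₁) (hpos i), fun t ht => ⟨?_, ?_⟩⟩
  · have := hmono (a := -C₁⁻¹) (b := 1) ht fun j => by
      linarith [(inv_mul_le_iff₀ hC₁).mpr (hφf j)]
    linarith
  · have := hmono (a := C₂) (b := -1) ht fun j => by linarith [hfφ j]
    linarith

lemma tendsto_log_div_of_exp_bounds {F : ℝ → ℝ} {c C : ℝ} (hc : 0 < c)
    (hF : ∀ t, 0 ≤ t → c * Real.exp (Λ * t) ≤ F t ∧ F t ≤ C * Real.exp (Λ * t)) :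
    Tendsto (fun t => Real.log (F t) / t) atTop (𝓝 Λ) := by
  have hC : 0 < C := hc.trans_le (by simpa using (hF 0 le_rfl).1.trans (hF 0 le_rfl).2)
  have hlim : ∀ d : ℝ, Tendsto (fun t : ℝ => (Real.log d + Λ * t) / t) atTop (𝓝 Λ) := fun d => by
    have := (tendsto_inv_atTop_zero.const_mul (Real.log d)).add_const Λ
    rw [mul_zero, zero_add] at this
    refine this.congr' ?_
    filter_upwards [eventually_ne_atTop 0] with t ht
    field_simp
  have hlog : ∀ {d t : ℝ}, 0 < d → Real.log (d * Real.exp (Λ * t)) = Real.log d + Λ * t := fun hd =>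
    by rw [Real.log_mul hd.ne' (Real.exp_pos _).ne', Real.log_exp]
  refine tendsto_of_tendsto_of_tendsto_of_le_of_le' (hlim c) (hlim C) ?_ ?_ <;>
    filter_upwards [eventually_gt_atTop 0] with t ht
  · rw [← hlog hc]
    gcongr
    exact (hF t ht.le).1
  · rw [← hlog hC]
    have : 0 < F t := (by positivity : 0 < c * Real.exp (Λ * t)).trans_le (hF t ht.le).1
    gcongr
    exact (hF t ht.le).2

end OperatorExponential

section JointProcess

/-! ### The moment generating function of the activity -/

variable {L : ℕ}

lemma occ_nonneg (η : Config L) (k : ZMod L) : 0 ≤ occ η k := by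
  unfold occ; split_ifs <;> norm_num

lemma occ_le_one (η : Config L) (k : ZMod L) : occ η k ≤ 1 := by
  unfold occ; split_ifs <;> norm_num

variable [NeZero L] {w μ s t : ℝ}

open Classical in
/-- The indicator function of a joint state, to which the semigroup is applied in
`transitionProb`. -/
def pointMass (y : JointState L) : JointState L → ℝ := fun z => if z = y then 1 else 0

/-- The generator tilted by the activity: every jump carries the additional weight `exp s`. It is
the generator of the joint process on functions of the form `(η, n) ↦ exp (s n) f η`. -/
def tiltedGenerator (w μ s : ℝ) (L : ℕ) [NeZero L] : (Config L → ℝ) →L[ℝ] (Config L → ℝ) :=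
  LinearMap.toContinuousLinearMap
    { toFun := fun f η => ∑ k : ZMod L,
        ((μ + w * (occ η k + occ η (k + 1)) * Real.exp s) * f (flip η k)
          - (μ + w * (occ η k + occ η (k + 1))) * f η)
      map_add' := fun f g => by
        ext η
        simp only [Pi.add_apply, ← Finset.sum_add_distrib]
        exact Finset.sum_congr rfl fun k _ => by ring
      map_smul' := fun c f => by
        ext η
        simp only [Pi.smul_apply, smul_eq_mul, Finset.mul_sum, RingHom.id_apply]
        exact Finset.sum_congr rfl fun k _ => by ring }

lemma tiltedGenerator_apply (f : Config L → ℝ) (η : Config L) :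
    tiltedGenerator w μ s L f η = ∑ k : ZMod L,
      ((μ + w * (occ η k + occ η (k + 1)) * Real.exp s) * f (flip η k)
        - (μ + w * (occ η k + occ η (k + 1))) * f η) := rfl

lemma exp_mul_natCast_succ (s : ℝ) (n : ℕ) :
    Real.exp (s * (n + 1 : ℕ)) = Real.exp (s * n) * Real.exp s := by
  rw [← Real.exp_add]
  push_cast
  ring_nf

lemma hasSum_iterate_jointGenerator_pointMass (w μ s : ℝ) (n : ℕ) (x : JointState L) :
    HasSum (fun y : JointState L =>
        Real.exp (s * y.2) * ((jointGenerator w μ L)^[n] (pointMass y)) x)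
      (Real.exp (s * x.2) * (tiltedGenerator w μ s L ^ n) 1 x.1) := by
  induction n generalizing x with
  | zero =>
    have := hasSum_single (f := fun y : JointState L => Real.exp (s * y.2) * pointMass y x) x
      fun y hy => by simp [pointMass, hy.symm]
    simpa [pointMass] using this
  | succ n ih =>
    have hstep : HasSum (_ : JointState L → ℝ) (_ : ℝ) :=
      hasSum_sum (s := (Finset.univ : Finset (ZMod L))) fun k _ =>
      (((ih (flip x.1 k, x.2)).mul_left μ).add
        ((ih (flip x.1 k, x.2 + 1)).mul_left (w * (occ x.1 k + occ x.1 (k + 1))))).sub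
        ((ih x).mul_left (μ + w * (occ x.1 k + occ x.1 (k + 1))))
    convert hstep using 1
    · ext y
      rw [Function.iterate_succ_apply', jointGenerator, Finset.mul_sum]
      exact Finset.sum_congr rfl fun k _ => by ring
    · rw [pow_succ', mul_apply_eq_comp, tiltedGenerator_apply, Finset.mul_sum]
      refine Finset.sum_congr rfl fun k _ => ?_
      rw [exp_mul_natCast_succ]
      ring

lemma abs_jointGenerator_le (hw : 0 ≤ w) (hμ : 0 ≤ μ) (f : JointState L → ℝ)
    (x : JointState L) :
    |jointGenerator w μ L f x| ≤ ∑ k : ZMod L, (μ * |f (flip x.1 k, x.2)|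
      + 2 * w * |f (flip x.1 k, x.2 + 1)| + (μ + 2 * w) * |f x|) := by
  refine (Finset.abs_sum_le_sum_abs _ _).trans (Finset.sum_le_sum fun k _ => ?_)
  have hrate : 0 ≤ w * (occ x.1 k + occ x.1 (k + 1)) :=
    mul_nonneg hw (add_nonneg (occ_nonneg _ _) (occ_nonneg _ _))
  have hrate_le : w * (occ x.1 k + occ x.1 (k + 1)) ≤ 2 * w := by
    nlinarith [occ_le_one x.1 k, occ_le_one x.1 (k + 1)]
  refine (abs_sub _ _).trans (add_le_add ((abs_add_le _ _).trans (add_le_add ?_ ?_)) ?_)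
  · rw [abs_mul, abs_of_nonneg hμ]
  · rw [abs_mul, abs_of_nonneg hrate]
    gcongr
  · rw [abs_mul, abs_of_nonneg (add_nonneg hμ hrate)]
    gcongr

lemma sum_mul_abs_jointGenerator_le {ι : Type*} {F : Finset ι} {p : ι → ℝ}
    {g : ι → JointState L → ℝ} {B : ℝ} (hw : 0 ≤ w) (hμ : 0 ≤ μ) (hp : ∀ y, 0 ≤ p y)
    (hg : ∀ x, ∑ y ∈ F, p y * |g y x| ≤ Real.exp (s * x.2) * B) (x : JointState L) :
    ∑ y ∈ F, p y * |jointGenerator w μ L (g y) x|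
      ≤ Real.exp (s * x.2) * (L * (2 * μ + 2 * w * (1 + Real.exp s)) * B) := by
  have hsite : ∀ k : ZMod L, μ * ∑ y ∈ F, p y * |g y (flip x.1 k, x.2)|
      + 2 * w * ∑ y ∈ F, p y * |g y (flip x.1 k, x.2 + 1)|
      + (μ + 2 * w) * ∑ y ∈ F, p y * |g y x|
      ≤ Real.exp (s * x.2) * ((2 * μ + 2 * w * (1 + Real.exp s)) * B) := fun k => by
    have hjump := hg (flip x.1 k, x.2 + 1)
    simp only [exp_mul_natCast_succ] at hjump
    calc _ ≤ μ * (Real.exp (s * x.2) * B) + 2 * w * (Real.exp (s * x.2) * Real.exp s * B)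
          + (μ + 2 * w) * (Real.exp (s * x.2) * B) := by
          gcongr
          · exact hg (flip x.1 k, x.2)
          · exact hg x
      _ = _ := by ring
  calc ∑ y ∈ F, p y * |jointGenerator w μ L (g y) x|
      ≤ ∑ y ∈ F, p y * ∑ k : ZMod L, (μ * |g y (flip x.1 k, x.2)|
        + 2 * w * |g y (flip x.1 k, x.2 + 1)| + (μ + 2 * w) * |g y x|) :=
        Finset.sum_le_sum fun y _ =>
          mul_le_mul_of_nonneg_left (abs_jointGenerator_le hw hμ _ _) (hp y)
    _ = ∑ k : ZMod L, (μ * ∑ y ∈ F, p y * |g y (flip x.1 k, x.2)|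
        + 2 * w * ∑ y ∈ F, p y * |g y (flip x.1 k, x.2 + 1)|
        + (μ + 2 * w) * ∑ y ∈ F, p y * |g y x|) := by
      simp only [Finset.mul_sum, ← Finset.sum_add_distrib]
      rw [Finset.sum_comm]
      exact Finset.sum_congr rfl fun _ _ => Finset.sum_congr rfl fun _ _ => by ring
    _ ≤ ∑ _k : ZMod L, Real.exp (s * x.2) * ((2 * μ + 2 * w * (1 + Real.exp s)) * B) :=
      Finset.sum_le_sum fun k _ => hsite k
    _ = _ := by
      rw [Finset.sum_const, Finset.card_univ, ZMod.card, nsmul_eq_mul]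
      ring

lemma sum_abs_iterate_jointGenerator_pointMass_le (hw : 0 ≤ w) (hμ : 0 ≤ μ) (s : ℝ) (n : ℕ)
    (F : Finset (JointState L)) (x : JointState L) :
    ∑ y ∈ F, Real.exp (s * y.2) * |((jointGenerator w μ L)^[n] (pointMass y)) x|
      ≤ Real.exp (s * x.2) * (L * (2 * μ + 2 * w * (1 + Real.exp s))) ^ n := by
  induction n generalizing x with
  | zero =>
    classical
    have hterm : ∀ y, Real.exp (s * y.2) * |((jointGenerator w μ L)^[0] (pointMass y)) x|
        = if x = y then Real.exp (s * y.2) else 0 := fun y => by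
      by_cases h : x = y <;> simp [pointMass, h]
    simp only [hterm, Finset.sum_ite_eq, pow_zero, mul_one]
    split_ifs <;> simp [Real.exp_nonneg]
  | succ n ih =>
    simp only [Function.iterate_succ_apply', pow_succ']
    exact sum_mul_abs_jointGenerator_le hw hμ (fun y => Real.exp_nonneg _) ih x

lemma summable_semigroup_pointMass (hw : 0 ≤ w) (hμ : 0 ≤ μ) (s : ℝ) (ht : 0 ≤ t)
    (x : JointState L) :
    Summable fun p : ℕ × JointState L => t ^ p.1 / (p.1.factorial : ℝ) *
      (Real.exp (s * p.2.2) * ((jointGenerator w μ L)^[p.1] (pointMass p.2)) x) := by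
  have hbound := fun n F => sum_abs_iterate_jointGenerator_pointMass_le (L := L) hw hμ s n F x
  set C : ℝ := L * (2 * μ + 2 * w * (1 + Real.exp s))
  have hsum : ∀ n : ℕ, Summable fun y : JointState L =>
      Real.exp (s * y.2) * |((jointGenerator w μ L)^[n] (pointMass y)) x| := fun n =>
    summable_of_sum_le (fun y => by positivity) (hbound n)
  apply Summable.of_abs
  rw [summable_prod_of_nonneg (fun p => abs_nonneg _)]
  simp only [abs_mul, Real.abs_exp, abs_div, abs_pow, Nat.abs_cast, abs_of_nonneg ht,
    tsum_mul_left]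
  refine ⟨fun n => (hsum n).mul_left _, ?_⟩
  refine Summable.of_nonneg_of_le
    (fun n => mul_nonneg (by positivity) (tsum_nonneg fun y => by positivity))
    (fun n => mul_le_mul_of_nonneg_left ((hsum n).tsum_le_of_sum_le (hbound n)) (by positivity)) ?_
  refine ((Real.summable_pow_div_factorial (t * C)).mul_left (Real.exp (s * x.2))).congr fun n => ?_
  rw [mul_pow]
  ring

lemma exp_mul_transitionProb (s t : ℝ) (x y : JointState L) :
    Real.exp (s * y.2) * transitionProb w μ L t x y = ∑' n : ℕ, t ^ n / (n.factorial : ℝ) *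
      (Real.exp (s * y.2) * ((jointGenerator w μ L)^[n] (pointMass y)) x) := by
  change Real.exp (s * y.2) * ∑' n : ℕ, t ^ n / (n.factorial : ℝ) *
    ((jointGenerator w μ L)^[n] (pointMass y)) x = _
  rw [← tsum_mul_left]
  exact tsum_congr fun n => by ring

lemma summable_exp_mul_transitionProb (hw : 0 ≤ w) (hμ : 0 ≤ μ) (s : ℝ) (ht : 0 ≤ t)
    (x : JointState L) :
    Summable fun y : JointState L => Real.exp (s * y.2) * transitionProb w μ L t x y := by
  simp only [exp_mul_transitionProb]
  exact (summable_semigroup_pointMass hw hμ s ht x).prod_symm.prod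

lemma activityMGF_eq_exp (hw : 0 ≤ w) (hμ : 0 ≤ μ) (s : ℝ) (ht : 0 ≤ t) (η : Config L) :
    activityMGF w μ L η s t = NormedSpace.exp (t • tiltedGenerator w μ s L) 1 η := by
  unfold activityMGF
  simp only [exp_mul_transitionProb]
  rw [(summable_semigroup_pointMass hw hμ s ht (η, 0)).tsum_comm]
  have hexp := (ContinuousLinearMap.proj (R := ℝ) (φ := fun _ => ℝ) η).hasSum
    (hasSum_exp_smul_apply (tiltedGenerator w μ s L) t 1)
  refine Eq.trans (tsum_congr fun n => ?_) hexp.tsum_eq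
  rw [tsum_mul_left, (hasSum_iterate_jointGenerator_pointMass w μ s n (η, 0)).tsum_eq]
  simp

lemma isCrossPositive_tiltedGenerator (hw : 0 ≤ w) (hμ : 0 ≤ μ) {S : Set (Config L)}
    (hS : ∀ η ∈ S, ∀ k, flip η k ∈ S) :
    IsCrossPositive (fun η : S => ContinuousLinearMap.proj (R := ℝ) (φ := fun _ => ℝ) η.1)
      (tiltedGenerator w μ s L) := by
  refine ⟨∑ _k : ZMod L, (μ + w * 2), fun f hf ⟨η, hη⟩ => ?_⟩
  have hf' : ∀ ξ ∈ S, 0 ≤ f ξ := fun ξ hξ => hf ⟨ξ, hξ⟩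
  simp only [ContinuousLinearMap.proj_apply]
  rw [tiltedGenerator_apply, Finset.sum_mul, ← Finset.sum_add_distrib]
  refine Finset.sum_nonneg fun k _ => ?_
  have hocc := add_nonneg (occ_nonneg η k) (occ_nonneg η (k + 1))
  have hflip : 0 ≤ (μ + w * (occ η k + occ η (k + 1)) * Real.exp s) * f (flip η k) :=
    mul_nonneg (by positivity) (hf' _ (hS η hη k))
  have hstay : 0 ≤ w * (2 - (occ η k + occ η (k + 1))) * f η :=
    mul_nonneg (mul_nonneg hw (by linarith [occ_le_one η k, occ_le_one η (k + 1)])) (hf' η hη)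
  linarith

lemma tendsto_log_activityMGF (hw : 0 ≤ w) (hμ : 0 ≤ μ) {S : Set (Config L)}
    (hS : ∀ η ∈ S, ∀ k, flip η k ∈ S) {φ : Config L → ℝ} {Λ : ℝ} (hpos : ∀ η ∈ S, 0 < φ η)
    (hφ : ∀ η ∈ S, tiltedGenerator w μ s L φ η = Λ * φ η) {η : Config L} (hη : η ∈ S) :
    Tendsto (fun t : ℝ => Real.log (activityMGF w μ L η s t) / (L * t)) atTop (𝓝 (Λ / L)) := by
  obtain ⟨c, C, hc, hbounds⟩ := (isCrossPositive_tiltedGenerator hw hμ hS).exists_exp_bounds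
    (f := 1) (fun ξ => hpos ξ ξ.2) (fun ξ => hφ ξ ξ.2) (fun _ => one_pos) ⟨η, hη⟩
  have hlim := (tendsto_log_div_of_exp_bounds hc (F := fun t => activityMGF w μ L η s t)
    fun t ht => by simp only [activityMGF_eq_exp hw hμ s ht]; exact hbounds t ht).div_const (L : ℝ)
  exact hlim.congr fun t => by rw [div_div, mul_comm]

end JointProcess

section RootsOfNegOne

/-! ### Fourier sums over the roots of `-1` -/

variable {L : ℕ} {z w : ℂ}

lemma sum_pow_of_pow_eq_one {K : Type*} [Field K] [DecidableEq K] {ω : K} (hω : ω ^ L = 1) :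
    ∑ n ∈ Finset.range L, ω ^ n = if ω = 1 then (L : K) else 0 := by
  split_ifs with h
  · simp [h]
  · rw [geom_sum_eq h, hω, sub_self, zero_div]

/-- The `L`-th roots of `-1`, that is, the unit complex numbers `exp (i q)` for the momenta `q` of
fermions with antiperiodic boundary conditions. -/
def negOneRoots (L : ℕ) : Finset ℂ := Polynomial.nthRootsFinset L (-1 : ℂ)

/-- The `j`-th momentum allowed by antiperiodic boundary conditions on `L` sites. -/
def momentum (L j : ℕ) : ℝ := Real.pi * (2 * j + 1) / L

variable [NeZero L]

lemma mem_negOneRoots : z ∈ negOneRoots L ↔ z ^ L = -1 :=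
  Polynomial.mem_nthRootsFinset (NeZero.pos L) _

lemma norm_of_mem_negOneRoots (hz : z ∈ negOneRoots L) : ‖z‖ = 1 := by
  have h := congrArg norm (mem_negOneRoots.mp hz)
  rwa [norm_pow, norm_neg, norm_one, pow_eq_one_iff_of_nonneg (norm_nonneg z) (NeZero.ne L)] at h

lemma ne_zero_of_mem_negOneRoots (hz : z ∈ negOneRoots L) : z ≠ 0 :=
  norm_ne_zero_iff.mp (norm_of_mem_negOneRoots hz ▸ one_ne_zero)

lemma inv_mem_negOneRoots (hz : z ∈ negOneRoots L) : z⁻¹ ∈ negOneRoots L := by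
  rw [mem_negOneRoots, inv_pow, mem_negOneRoots.mp hz, inv_neg_one]

lemma sum_negOneRoots_inv {M : Type*} [AddCommMonoid M] (f : ℂ → M) :
    ∑ z ∈ negOneRoots L, f z⁻¹ = ∑ z ∈ negOneRoots L, f z :=
  Finset.sum_nbij' (·⁻¹) (·⁻¹) (fun _ => inv_mem_negOneRoots) (fun _ => inv_mem_negOneRoots)
    (fun _ _ => inv_inv _) (fun _ _ => inv_inv _) (fun _ _ => rfl)

lemma sum_mul_pow_of_mem_negOneRoots (hz : z ∈ negOneRoots L) (hw : w ∈ negOneRoots L) :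
    ∑ n ∈ Finset.range L, (z * w) ^ n = if z * w = 1 then (L : ℂ) else 0 :=
  sum_pow_of_pow_eq_one <| by
    rw [mul_pow, mem_negOneRoots.mp hz, mem_negOneRoots.mp hw, neg_mul_neg, one_mul]

lemma cexp_momentum_eq (L j : ℕ) [NeZero L] : Complex.exp (momentum L j * Complex.I) =
    Complex.exp (2 * Real.pi * Complex.I / L) ^ j * Complex.exp (momentum L 0 * Complex.I) := by
  have : (L : ℂ) ≠ 0 := NeZero.ne _
  rw [← Complex.exp_nat_mul, ← Complex.exp_add]
  congr 1
  simp only [momentum]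
  push_cast
  field_simp
  ring

lemma cexp_momentum_mem_negOneRoots (L j : ℕ) [NeZero L] :
    Complex.exp (momentum L j * Complex.I) ∈ negOneRoots L := by
  have : (L : ℂ) ≠ 0 := NeZero.ne _
  rw [mem_negOneRoots, ← Complex.exp_nat_mul, momentum]
  have harg : (L : ℂ) * ((Real.pi * (2 * j + 1) / L : ℝ) * Complex.I) =
      Real.pi * Complex.I + j * (2 * Real.pi * Complex.I) := by
    push_cast
    field_simp
    ring
  rw [harg, Complex.exp_add, Complex.exp_nat_mul_two_pi_mul_I, Complex.exp_pi_mul_I, mul_one]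

lemma sum_negOneRoots {M : Type*} [AddCommMonoid M] (f : ℂ → M) :
    ∑ z ∈ negOneRoots L, f z =
      ∑ j ∈ Finset.range L, f (Complex.exp (momentum L j * Complex.I)) := by
  have hprim := Complex.isPrimitiveRoot_exp L (NeZero.ne L)
  have hroots : Polynomial.nthRoots L (-1 : ℂ) =
      (Multiset.range L).map fun j => Complex.exp (momentum L j * Complex.I) := by
    rw [hprim.nthRoots_eq (mem_negOneRoots.mp (cexp_momentum_mem_negOneRoots L 0))]
    exact Multiset.map_congr rfl fun j _ => (cexp_momentum_eq L j).symm
  have hval : (negOneRoots L).val = Polynomial.nthRoots L (-1 : ℂ) := by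
    rw [negOneRoots, Polynomial.nthRootsFinset_def]
    exact (hprim.nthRoots_nodup (neg_ne_zero.mpr one_ne_zero)).dedup
  rw [Finset.sum_eq_multiset_sum, hval, hroots, Multiset.map_map]
  rfl

lemma sum_negOneRoots_inv_pow_mul_pow {m n : ℕ} (hm : m < L) (hn : n < L) :
    ∑ z ∈ negOneRoots L, z⁻¹ ^ n * z ^ m = if m = n then (L : ℂ) else 0 := by
  set ω := Complex.exp (2 * Real.pi * Complex.I / L)
  have hω : IsPrimitiveRoot ω L := Complex.isPrimitiveRoot_exp L (NeZero.ne L)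
  have hω0 : ω ≠ 0 := Complex.exp_ne_zero _
  have hquot : ω ^ m / ω ^ n = 1 ↔ m = n := by
    rw [div_eq_one_iff_eq (pow_ne_zero _ hω0)]
    exact ⟨hω.pow_inj hm hn, fun h => h ▸ rfl⟩
  have hterm : ∀ j, (Complex.exp (momentum L j * Complex.I))⁻¹ ^ n *
      Complex.exp (momentum L j * Complex.I) ^ m = (Complex.exp (momentum L 0 * Complex.I))⁻¹ ^ n *
      Complex.exp (momentum L 0 * Complex.I) ^ m * (ω ^ m / ω ^ n) ^ j := fun j => by
    rw [cexp_momentum_eq L j, mul_inv, mul_pow, mul_pow, inv_pow, ← pow_mul, div_pow, ← pow_mul,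
      ← pow_mul, ← pow_mul, mul_comm j n, mul_comm j m]
    ring
  have hpow : (ω ^ m / ω ^ n) ^ L = 1 := by
    rw [div_pow, ← pow_mul, ← pow_mul, mul_comm m, mul_comm n, pow_mul, pow_mul, hω.pow_eq_one,
      one_pow, one_pow, div_one]
  rw [sum_negOneRoots, Finset.sum_congr rfl fun j _ => hterm j, ← Finset.mul_sum,
    sum_pow_of_pow_eq_one hpow]
  split_ifs with h h' h'
  · rw [h', ← mul_pow, inv_mul_cancel₀ (Complex.exp_ne_zero _), one_pow, one_mul]
  · exact absurd (hquot.mp h) h'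
  · exact absurd (hquot.mpr h') h
  · rw [mul_zero]

section FourierSum

variable {M : Type*} [AddCommGroup M] [Module ℂ M]

/-- The discrete Fourier sum of a sequence. -/
def fourierSum (L : ℕ) (A : ℕ → M) (z : ℂ) : M := ∑ n ∈ Finset.range L, z ^ n • A n

omit [NeZero L] in
lemma fourierSum_apply (A : ℕ → Module.End ℂ M) (z : ℂ) (v : M) :
    fourierSum L A z v = fourierSum L (fun n => A n v) z := by
  simp only [fourierSum, LinearMap.sum_apply, LinearMap.smul_apply]

lemma sum_inv_pow_smul_fourierSum {A : ℕ → M} (hA : A L = -A 0) {n : ℕ} (hn : n ≤ L) :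
    ∑ z ∈ negOneRoots L, z⁻¹ ^ n • fourierSum L A z = (L : ℂ) • A n := by
  have hlt : ∀ n < L, ∑ z ∈ negOneRoots L, z⁻¹ ^ n • fourierSum L A z = (L : ℂ) • A n := by
    intro n hn
    simp only [fourierSum, Finset.smul_sum, smul_smul]
    rw [Finset.sum_comm]
    simp only [← Finset.sum_smul]
    rw [Finset.sum_congr rfl fun m hm => by
      rw [sum_negOneRoots_inv_pow_mul_pow (Finset.mem_range.mp hm) hn]]
    simp [hn]
  rcases hn.lt_or_eq with h | rfl
  · exact hlt n h
  · rw [hA, smul_neg, ← hlt 0 (NeZero.pos n), ← Finset.sum_neg_distrib]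
    refine Finset.sum_congr rfl fun z hz => ?_
    rw [mem_negOneRoots.mp (inv_mem_negOneRoots hz), pow_zero, neg_smul]

lemma smul_sum_shift_eq_sum_fourierSum (A : ℕ → Module.End ℂ M) {x : ℕ → M} (hx : x L = -x 0)
    {k : ℕ} (hk : k ≤ 1) :
    (L : ℂ) • ∑ n ∈ Finset.range L, A n (x (n + k)) =
      ∑ z ∈ negOneRoots L, z⁻¹ ^ k • fourierSum L A z⁻¹ (fourierSum L x z) := by
  have hterm : ∀ n ∈ Finset.range L, (L : ℂ) • A n (x (n + k)) =
      ∑ z ∈ negOneRoots L, z⁻¹ ^ k • z⁻¹ ^ n • A n (fourierSum L x z) := by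
    intro n hn
    have hn := Finset.mem_range.mp hn
    rw [← map_smul, ← sum_inv_pow_smul_fourierSum hx (by lia), map_sum]
    exact Finset.sum_congr rfl fun z _ => by rw [map_smul, pow_add, mul_comm, mul_smul]
  rw [Finset.smul_sum, Finset.sum_congr rfl hterm, Finset.sum_comm]
  exact Finset.sum_congr rfl fun z _ => by rw [fourierSum_apply, ← Finset.smul_sum]; rfl

lemma fourierSum_anticommutator {𝒜 : Type*} [Ring 𝒜] [Algebra ℂ 𝒜] {A B : ℕ → 𝒜} {c : ℂ}
    (h : ∀ m < L, ∀ n < L, A m * B n + B n * A m = (if m = n then c else 0) • 1)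
    (hz : z ∈ negOneRoots L) (hw : w ∈ negOneRoots L) :
    fourierSum L A z * fourierSum L B w + fourierSum L B w * fourierSum L A z =
      (if z * w = 1 then c * L else 0) • 1 := by
  have hterm : ∀ m ∈ Finset.range L, ∀ n ∈ Finset.range L,
      z ^ m • A m * w ^ n • B n + w ^ n • B n * z ^ m • A m =
        (if m = n then c * (z * w) ^ m else 0) • 1 := by
    intro m hm n hn
    rw [smul_mul_smul_comm, smul_mul_smul_comm, mul_comm (w ^ n), ← smul_add,
      h m (Finset.mem_range.mp hm) n (Finset.mem_range.mp hn), smul_smul]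
    split_ifs with hmn
    · rw [hmn, mul_pow, mul_comm]
    · rw [mul_zero]
  calc _ = ∑ m ∈ Finset.range L, ∑ n ∈ Finset.range L,
        (if m = n then c * (z * w) ^ m else 0) • (1 : 𝒜) := by
        rw [fourierSum, fourierSum, Finset.sum_mul_sum, Finset.sum_mul_sum, Finset.sum_comm
          (f := fun i j => w ^ i • B i * z ^ j • A j), ← Finset.sum_add_distrib]
        refine Finset.sum_congr rfl fun m hm => ?_
        rw [← Finset.sum_add_distrib]
        exact Finset.sum_congr rfl fun n hn => hterm m hm n hn
    _ = (c * ∑ n ∈ Finset.range L, (z * w) ^ n) • (1 : 𝒜) := by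
        rw [Finset.mul_sum, Finset.sum_smul]
        refine Finset.sum_congr rfl fun m hm => ?_
        rw [← Finset.sum_smul, Finset.sum_ite_eq, if_pos hm]
    _ = _ := by rw [sum_mul_pow_of_mem_negOneRoots hz hw, mul_ite, mul_zero]

end FourierSum

end RootsOfNegOne

section JordanWigner

/-! ### Jordan–Wigner transformation of the XY chain -/

variable {L : ℕ}

/-- The eigenvalue of `σᶻ` at a site with the given occupation. -/
def spin (b : Bool) : ℂ := if b then -1 else 1

lemma spin_not (b : Bool) : spin (!b) = -spin b := by cases b <;> simp [spin]

lemma spin_mul_self (b : Bool) : spin b * spin b = 1 := by cases b <;> simp [spin]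

/-- The Jordan–Wigner sign `(-1) ^ N`, with `N` the number of particles on the sites
`0, …, n - 1`. -/
def jwSign (η : Config L) (n : ℕ) : ℂ := ∏ i ∈ Finset.range n, spin (η i)

lemma jwSign_zero (η : Config L) : jwSign η 0 = 1 := Finset.prod_range_zero _

lemma jwSign_succ (η : Config L) (n : ℕ) : jwSign η (n + 1) = jwSign η n * spin (η n) :=
  Finset.prod_range_succ _ _

lemma jwSign_mul_self (η : Config L) (n : ℕ) : jwSign η n * jwSign η n = 1 := by
  simp only [jwSign, ← Finset.prod_mul_distrib, spin_mul_self, Finset.prod_const_one]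

lemma jwSign_eq_one_or (η : Config L) (n : ℕ) : jwSign η n = 1 ∨ jwSign η n = -1 :=
  mul_self_eq_one_iff.mp (jwSign_mul_self η n)

lemma star_jwSign (η : Config L) (n : ℕ) : star (jwSign η n) = jwSign η n := by
  rcases jwSign_eq_one_or η n with h | h <;> simp [h]

/-- The configuration with the occupation number at the single site `n` flipped. -/
def siteFlip (n : ℕ) (η : Config L) : Config L := Function.update η n (!η n)

lemma natCast_zmod_inj {m n : ℕ} (hm : m < L) (hn : n < L) : (m : ZMod L) = n ↔ m = n := by
  rw [ZMod.natCast_eq_natCast_iff', Nat.mod_eq_of_lt hm, Nat.mod_eq_of_lt hn]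

lemma siteFlip_siteFlip (n : ℕ) (η : Config L) : siteFlip n (siteFlip n η) = η := by
  simp [siteFlip]

lemma siteFlip_comm (m n : ℕ) (η : Config L) :
    siteFlip m (siteFlip n η) = siteFlip n (siteFlip m η) := by
  by_cases h : (m : ZMod L) = n
  · simp [siteFlip, h]
  · simp only [siteFlip, Function.update_of_ne h, Function.update_of_ne (Ne.symm h)]
    exact (Function.update_comm h _ _ _).symm

lemma siteFlip_self_eq_siteFlip_zero (η : Config L) : siteFlip L η = siteFlip 0 η := by
  simp [siteFlip]

lemma jwSign_siteFlip {m n : ℕ} (hm : m < L) (hn : n ≤ L) (η : Config L) :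
    jwSign (siteFlip m η) n = (if m < n then -1 else 1) * jwSign η n := by
  induction n with
  | zero => simp [jwSign_zero]
  | succ n ih =>
    rw [jwSign_succ, jwSign_succ, ih (by lia)]
    by_cases h : m = n
    · subst h
      simp [siteFlip, spin_not]
    · have hne : (n : ZMod L) ≠ m := mt (natCast_zmod_inj (by lia) hm).mp (Ne.symm h)
      rw [siteFlip, Function.update_of_ne hne]
      simp only [show m < n + 1 ↔ m < n by lia]
      ring

lemma jwSign_siteFlip_self {m : ℕ} (hm : m < L) (η : Config L) :
    jwSign (siteFlip m η) L = -jwSign η L := by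
  rw [jwSign_siteFlip hm le_rfl, if_pos hm, neg_one_mul]

lemma add_one_ne_self (hL : 2 ≤ L) (k : ZMod L) : k + 1 ≠ k := by
  have : Fact (1 < L) := ⟨hL⟩
  simp

lemma flip_natCast (hL : 2 ≤ L) (n : ℕ) (η : Config L) :
    flip η n = siteFlip (n + 1) (siteFlip n η) := by
  have hne := add_one_ne_self hL (n : ZMod L)
  ext j
  simp only [flip, siteFlip, Nat.cast_add, Nat.cast_one, Function.update_apply]
  rcases eq_or_ne j (n + 1) with rfl | hsucc
  · simp only [hne, or_true, if_true, if_false]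
  · rcases eq_or_ne j n with rfl | hn
    · simp only [hsucc, or_false, if_true, if_false]
    · simp only [hsucc, hn, or_false, if_false]

/-- The site flip at `n` times the Jordan–Wigner sign of the sites below `j`. For `j = n` and
`j = n + 1` these are the two Majorana operators at site `n`. -/
def majorana (n j : ℕ) : Module.End ℂ (Config L → ℂ) where
  toFun v η := jwSign η j * v (siteFlip n η)
  map_add' u v := by ext η; exact mul_add _ _ _
  map_smul' c v := by ext η; exact mul_left_comm _ _ _

/-- The Majorana operator `σˣ` at site `n`, dressed with the Jordan–Wigner string. -/
abbrev majoranaX (n : ℕ) : Module.End ℂ (Config L → ℂ) := majorana n n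

/-- The Majorana operator `σᶻσˣ` at site `n`, dressed with the Jordan–Wigner string. It is
normalized to be real, hence squares to `-1`. -/
abbrev majoranaY (n : ℕ) : Module.End ℂ (Config L → ℂ) := majorana n (n + 1)

lemma majorana_apply (n j : ℕ) (v : Config L → ℂ) (η : Config L) :
    majorana n j v η = jwSign η j * v (siteFlip n η) := rfl

lemma majorana_majorana_apply {n i : ℕ} (hn : n < L) (hi : i ≤ L) (m j : ℕ) (v : Config L → ℂ)
    (η : Config L) : majorana n j (majorana m i v) η =
      (if n < i then -1 else 1) * (jwSign η j * jwSign η i) * v (siteFlip m (siteFlip n η)) := by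
  rw [majorana_apply, majorana_apply, jwSign_siteFlip hn hi]
  ring

lemma majorana_mul_self {n i : ℕ} (hn : n < L) (hi : i ≤ L) :
    (majorana n i * majorana n i : Module.End ℂ (Config L → ℂ)) =
      (if n < i then -1 else 1 : ℂ) • 1 := by
  ext1 v; funext η
  rw [Module.End.mul_apply, majorana_majorana_apply hn hi, jwSign_mul_self, siteFlip_siteFlip,
    mul_one]
  rfl

lemma majorana_anticommutator {m n i j : ℕ} (hm : m < L) (hn : n < L) (hi : i ≤ L) (hj : j ≤ L)
    (hij : m < j ↔ ¬ n < i) :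
    (majorana m i * majorana n j + majorana n j * majorana m i : Module.End ℂ (Config L → ℂ))
      = 0 := by
  ext1 v; funext η
  simp only [LinearMap.add_apply, Module.End.mul_apply, Pi.add_apply, LinearMap.zero_apply,
    Pi.zero_apply]
  rw [majorana_majorana_apply hm hj, majorana_majorana_apply hn hi, siteFlip_comm m n]
  by_cases h : n < i
  · rw [if_neg (by tauto), if_pos h]; ring
  · rw [if_pos (by tauto), if_neg h]; ring

lemma majoranaX_anticommutator {m n : ℕ} (hm : m < L) (hn : n < L) :
    (majoranaX m * majoranaX n + majoranaX n * majoranaX m : Module.End ℂ (Config L → ℂ)) =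
      (if m = n then (2 : ℂ) else 0) • 1 := by
  split_ifs with h
  · subst h
    rw [majorana_mul_self hm hm.le, if_neg (lt_irrefl m), ← add_smul, one_add_one_eq_two]
  · rw [majorana_anticommutator hm hn hm.le hn.le (by lia), zero_smul]

lemma majoranaY_anticommutator {m n : ℕ} (hm : m < L) (hn : n < L) :
    (majoranaY m * majoranaY n + majoranaY n * majoranaY m : Module.End ℂ (Config L → ℂ)) =
      (if m = n then (-2 : ℂ) else 0) • 1 := by
  split_ifs with h
  · subst h
    rw [majorana_mul_self hm hm, if_pos m.lt_succ_self, ← add_smul, ← neg_add, one_add_one_eq_two]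
  · rw [majorana_anticommutator hm hn hm hn (by lia), zero_smul]

lemma majoranaX_majoranaY_anticommutator {m n : ℕ} (hm : m < L) (hn : n < L) :
    (majoranaX m * majoranaY n + majoranaY n * majoranaX m : Module.End ℂ (Config L → ℂ)) = 0 :=
  majorana_anticommutator hm hn hm.le hn (by lia)

lemma majoranaY_majoranaX_succ_apply (hL : 2 ≤ L) {n : ℕ} (hn : n < L) (v : Config L → ℂ)
    (η : Config L) : majoranaY n (majoranaX (n + 1) v) η = -v (flip η n) := by
  rw [majorana_majorana_apply hn hn, if_pos n.lt_succ_self, jwSign_mul_self, flip_natCast hL,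
    mul_one, neg_one_mul]

lemma majoranaX_majoranaY_succ_apply (hL : 2 ≤ L) {n : ℕ} (hn : n < L) (v : Config L → ℂ)
    (η : Config L) :
    majoranaX n (majoranaY (n + 1) v) η = -(spin (η n) * spin (η (n + 1))) * v (flip η n) := by
  rw [majorana_apply, majorana_apply, jwSign_succ, jwSign_succ, jwSign_siteFlip hn hn.le,
    if_neg (lt_irrefl n), flip_natCast hL, siteFlip, Function.update_self, Nat.cast_add,
    Nat.cast_one, Function.update_of_ne (add_one_ne_self hL n), spin_not]
  linear_combination (-spin (η n) * spin (η (n + 1)) *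
    v (siteFlip (n + 1) (Function.update η n (!η n)))) * jwSign_mul_self η n

lemma majoranaX_majoranaY_self_apply {n : ℕ} (hn : n < L) (v : Config L → ℂ) (η : Config L) :
    majoranaX n (majoranaY n v) η = -spin (η n) * v η := by
  rw [majorana_majorana_apply hn hn, if_pos n.lt_succ_self, jwSign_succ, siteFlip_siteFlip]
  linear_combination (-spin (η n) * v η) * jwSign_mul_self η n

/-- Vectors supported on the configurations with an even number of particles. -/
def IsEvenVec (v : Config L → ℂ) : Prop := ∀ η, jwSign η L = -1 → v η = 0

variable [NeZero L]

lemma IsEvenVec.jwSign_mul_siteFlip_zero {v : Config L → ℂ} (hv : IsEvenVec v) (η : Config L) :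
    jwSign η L * v (siteFlip 0 η) = -v (siteFlip 0 η) := by
  rcases jwSign_eq_one_or η L with h | h
  · rw [hv _ (by rw [jwSign_siteFlip_self (NeZero.pos L), h]), mul_zero, neg_zero]
  · rw [h, neg_one_mul]

lemma IsEvenVec.majoranaX_antiperiodic {v : Config L → ℂ} (hv : IsEvenVec v) :
    majoranaX L v = -majoranaX 0 v := by
  funext η
  rw [Pi.neg_apply, majorana_apply, majorana_apply, siteFlip_self_eq_siteFlip_zero,
    hv.jwSign_mul_siteFlip_zero, jwSign_zero, one_mul]

lemma IsEvenVec.majoranaY_antiperiodic {v : Config L → ℂ} (hv : IsEvenVec v) :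
    majoranaY L v = -majoranaY 0 v := by
  funext η
  rw [Pi.neg_apply, majorana_apply, majorana_apply, siteFlip_self_eq_siteFlip_zero, jwSign_succ,
    jwSign_succ, jwSign_zero, Nat.cast_zero, ZMod.natCast_self, mul_right_comm,
    hv.jwSign_mul_siteFlip_zero, one_mul, neg_mul, mul_comm]

@[to_additive]
lemma prod_zmod_eq_prod_range {M : Type*} [CommMonoid M] (f : ZMod L → M) :
    ∏ k, f k = ∏ n ∈ Finset.range L, f n := by
  refine Finset.prod_nbij' ZMod.val (fun n => n) (fun k _ => ?_) (fun _ _ => Finset.mem_univ _)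
    (fun k _ => ZMod.natCast_zmod_val k) (fun n hn => ?_) (fun k _ => ?_)
  · exact Finset.mem_range.mpr (ZMod.val_lt k)
  · exact ZMod.val_cast_of_lt (Finset.mem_range.mp hn)
  · rw [ZMod.natCast_zmod_val]

/-- The Hamiltonian of the XY chain in the transverse field `h`, with sign such that its top
eigenvalue is relevant: flipping a bond has weight `b` if its two sites have equal occupation and
weight `a` otherwise. -/
def xyHamiltonian (h a b : ℝ) (v : Config L → ℂ) : Config L → ℂ := fun η =>
  ∑ k : ZMod L, ((if η k = η (k + 1) then (b : ℂ) else a) * v (flip η k) + h * spin (η k) * v η)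

lemma xyHamiltonian_eq_sum_majorana (hL : 2 ≤ L) (h a b : ℝ) (v : Config L → ℂ) :
    xyHamiltonian h a b v =
      (-((a + b) / 2 : ℂ)) • ∑ n ∈ Finset.range L, majoranaY n (majoranaX (n + 1) v)
      + (-((b - a) / 2 : ℂ)) • ∑ n ∈ Finset.range L, majoranaX n (majoranaY (n + 1) v)
      + (-(h : ℂ)) • ∑ n ∈ Finset.range L, majoranaX n (majoranaY n v) := by
  funext η
  rw [xyHamiltonian, sum_zmod_eq_sum_range]
  simp only [Finset.smul_sum, ← Finset.sum_add_distrib, Finset.sum_apply]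
  refine Finset.sum_congr rfl fun n hn => ?_
  have hn := Finset.mem_range.mp hn
  simp only [Pi.add_apply, Pi.smul_apply, smul_eq_mul]
  rw [majoranaY_majoranaX_succ_apply hL hn, majoranaX_majoranaY_succ_apply hL hn,
    majoranaX_majoranaY_self_apply hn]
  cases η n <;> cases η ((n : ZMod L) + 1) <;> simp [spin] <;> ring

/-- The Fourier sum of the Majorana operators `majoranaX`. -/
abbrev fourierX (z : ℂ) : Module.End ℂ (Config L → ℂ) := fourierSum L majoranaX z

/-- The Fourier sum of the Majorana operators `majoranaY`. -/
abbrev fourierY (z : ℂ) : Module.End ℂ (Config L → ℂ) := fourierSum L majoranaY z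

variable {z w : ℂ}

lemma fourierX_anticommutator (hz : z ∈ negOneRoots L) (hw : w ∈ negOneRoots L) :
    (fourierX z * fourierX w + fourierX w * fourierX z : Module.End ℂ (Config L → ℂ)) =
      (if z * w = 1 then 2 * (L : ℂ) else 0) • 1 :=
  fourierSum_anticommutator (fun _ hm _ => majoranaX_anticommutator hm) hz hw

lemma fourierY_anticommutator (hz : z ∈ negOneRoots L) (hw : w ∈ negOneRoots L) :
    (fourierY z * fourierY w + fourierY w * fourierY z : Module.End ℂ (Config L → ℂ)) =
      (if z * w = 1 then -2 * (L : ℂ) else 0) • 1 :=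
  fourierSum_anticommutator (fun _ hm _ => majoranaY_anticommutator hm) hz hw

lemma fourierX_mul_fourierY (hz : z ∈ negOneRoots L) (hw : w ∈ negOneRoots L) :
    (fourierX z * fourierY w : Module.End ℂ (Config L → ℂ)) = -(fourierY w * fourierX z) := by
  have := fourierSum_anticommutator (𝒜 := Module.End ℂ (Config L → ℂ)) (c := 0)
    (fun m hm n hn => by
      rw [ite_self, zero_smul]
      exact majoranaX_majoranaY_anticommutator hm hn) hz hw
  rw [zero_mul, ite_self, zero_smul] at this
  exact eq_neg_of_add_eq_zero_left this

/-- The function on the unit circle whose values at the roots of `-1` are the coefficients of the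
Hamiltonian as a quadratic form in the Fourier transformed Majorana operators. -/
def symbol (h a b : ℝ) (z : ℂ) : ℂ := 2 * h - (a + b) * z⁻¹ + (b - a) * z

lemma smul_xyHamiltonian_eq_sum_symbol (hL : 2 ≤ L) (h a b : ℝ) {v : Config L → ℂ}
    (hv : IsEvenVec v) :
    (L : ℂ) • xyHamiltonian h a b v =
      ∑ z ∈ negOneRoots L, (symbol h a b z / 2) • fourierY z⁻¹ (fourierX z v) := by
  have hYX : (L : ℂ) • ∑ n ∈ Finset.range L, majoranaY n (majoranaX (n + 1) v) =
      ∑ z ∈ negOneRoots L, z⁻¹ • fourierY z⁻¹ (fourierX z v) := by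
    have := smul_sum_shift_eq_sum_fourierSum majoranaY (x := fun n => majoranaX n v)
      hv.majoranaX_antiperiodic le_rfl
    simpa only [fourierSum_apply majoranaX, pow_one] using this
  have hXY : ∀ k ≤ 1, (L : ℂ) • ∑ n ∈ Finset.range L, majoranaX n (majoranaY (n + k) v) =
      ∑ z ∈ negOneRoots L, -z ^ k • fourierY z⁻¹ (fourierX z v) := fun k hk => by
    rw [smul_sum_shift_eq_sum_fourierSum majoranaX (x := fun n => majoranaY n v)
      hv.majoranaY_antiperiodic hk, ← sum_negOneRoots_inv]
    refine Finset.sum_congr rfl fun z hz => ?_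
    rw [inv_inv, ← fourierSum_apply, ← Module.End.mul_apply,
      fourierX_mul_fourierY hz (inv_mem_negOneRoots hz), LinearMap.neg_apply, smul_neg, neg_smul,
      Module.End.mul_apply]
  have hXY₀ := hXY 0 zero_le_one
  simp only [add_zero] at hXY₀
  rw [xyHamiltonian_eq_sum_majorana hL, smul_add, smul_add, smul_comm, hYX, smul_comm,
    hXY 1 le_rfl, smul_comm, hXY₀]
  simp only [Finset.smul_sum, ← Finset.sum_add_distrib, smul_smul, ← add_smul]
  refine Finset.sum_congr rfl fun z _ => congrArg (· • _) ?_
  rw [symbol]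
  ring

end JordanWigner

section Bogoliubov

/-! ### Diagonalization by Bogoliubov operators -/

variable {L : ℕ} {h a b : ℝ} {p q z w : ℂ}

lemma conj_symbol (h a b : ℝ) (hz : ‖z‖ = 1) :
    starRingEnd ℂ (symbol h a b z) = symbol h a b z⁻¹ := by
  rw [symbol, symbol, inv_inv, Complex.inv_eq_conj hz]
  simp [map_ofNat]

lemma symbol_re (h a b : ℝ) (hz : ‖z‖ = 1) : (symbol h a b z).re = 2 * h - 2 * a * z.re := by
  simp only [symbol, Complex.inv_eq_conj hz]
  simp
  ring

lemma symbol_im (h a b : ℝ) (hz : ‖z‖ = 1) : (symbol h a b z).im = 2 * b * z.im := by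
  simp only [symbol, Complex.inv_eq_conj hz]
  simp
  ring

lemma norm_symbol_inv (h a b : ℝ) (hz : ‖z‖ = 1) : ‖symbol h a b z⁻¹‖ = ‖symbol h a b z‖ := by
  rw [← conj_symbol h a b hz, RCLike.norm_conj]

lemma eq_one_or_neg_one_of_norm_eq_one (hz : ‖z‖ = 1) (him : z.im = 0) : z = 1 ∨ z = -1 := by
  have hre : z = z.re := Complex.ext rfl him
  rw [hre, Complex.norm_real, Real.norm_eq_abs] at hz
  rcases eq_or_eq_neg_of_abs_eq hz with h | h
  · left; rw [hre, h, Complex.ofReal_one]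
  · right; rw [hre, h, Complex.ofReal_neg, Complex.ofReal_one]

lemma symbol_neg_one (h a b : ℝ) : symbol h a b (-1) = (2 * (h + a) : ℝ) := by
  rw [symbol]
  push_cast
  ring

lemma symbol_ne_zero (hh : 0 ≤ h) (ha : 0 < a) (hb : 0 < b) (hz : ‖z‖ = 1) (hz₁ : z ≠ 1) :
    symbol h a b z ≠ 0 := by
  intro hσ
  have him : z.im = 0 := by
    have := symbol_im h a b hz
    rw [hσ, Complex.zero_im, eq_comm] at this
    exact (mul_eq_zero.mp this).resolve_left (by positivity)
  rw [(eq_one_or_neg_one_of_norm_eq_one hz him).resolve_left hz₁, symbol_neg_one,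
    Complex.ofReal_eq_zero] at hσ
  linarith

/-- The complex phase by which the Bogoliubov transformation mixes the two Majorana modes. -/
def phase (h a b : ℝ) (z : ℂ) : ℂ := starRingEnd ℂ (symbol h a b z) / ‖symbol h a b z‖

lemma phase_inv (h a b : ℝ) (hz : ‖z‖ = 1) :
    phase h a b z⁻¹ = starRingEnd ℂ (phase h a b z) := by
  rw [phase, phase, map_div₀, Complex.conj_ofReal, norm_symbol_inv h a b hz, conj_symbol h a b hz]

lemma norm_phase (hσ : symbol h a b z ≠ 0) : ‖phase h a b z‖ = 1 := by
  rw [phase, norm_div, RCLike.norm_conj, Complex.norm_real, norm_norm,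
    div_self (norm_ne_zero_iff.mpr hσ)]

lemma norm_symbol_mul_conj_phase (hσ : symbol h a b z ≠ 0) :
    ‖symbol h a b z‖ * starRingEnd ℂ (phase h a b z) = symbol h a b z := by
  have : (‖symbol h a b z‖ : ℂ) ≠ 0 := Complex.ofReal_ne_zero.mpr (norm_ne_zero_iff.mpr hσ)
  rw [phase, map_div₀, Complex.conj_conj, Complex.conj_ofReal, mul_div_cancel₀ _ this]

/-- The fermionic operator mixing the Fourier transformed Majorana operators with relative
phase `p`. For `p = 1` it annihilates particles. -/
def modeOperator (p z : ℂ) : Module.End ℂ (Config L → ℂ) := fourierX z + p • fourierY z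

lemma modeOperator_apply (p z : ℂ) (v : Config L → ℂ) (η : Config L) : modeOperator p z v η =
    ∑ n ∈ Finset.range L, z ^ n * (jwSign η n + p * jwSign η (n + 1)) * v (siteFlip n η) := by
  simp only [modeOperator, fourierSum, LinearMap.add_apply, LinearMap.smul_apply,
    LinearMap.sum_apply, Pi.add_apply, Pi.smul_apply, Finset.sum_apply, smul_eq_mul,
    majorana_apply, Finset.mul_sum, ← Finset.sum_add_distrib]
  exact Finset.sum_congr rfl fun n _ => by ring

/-- The annihilation operators of the quasiparticles diagonalizing the Hamiltonian. -/
abbrev bogoliubov (h a b : ℝ) (z : ℂ) : Module.End ℂ (Config L → ℂ) :=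
  modeOperator (phase h a b z) z

/-- The top of the spectrum of the Hamiltonian in the even sector. -/
def topEnergy (L : ℕ) (h a b : ℝ) : ℝ := 1 / 2 * ∑ z ∈ negOneRoots L, ‖symbol h a b z‖

variable [NeZero L]

lemma symbol_ne_zero_of_mem_negOneRoots (hh : 0 ≤ h) (ha : 0 < a) (hb : 0 < b)
    (hz : z ∈ negOneRoots L) : symbol h a b z ≠ 0 := by
  refine symbol_ne_zero hh ha hb (norm_of_mem_negOneRoots hz) ?_
  rintro rfl
  have := mem_negOneRoots.mp hz
  norm_num at this

lemma modeOperator_anticommutator (hz : z ∈ negOneRoots L) (hw : w ∈ negOneRoots L) :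
    (modeOperator p z * modeOperator q w + modeOperator q w * modeOperator p z :
      Module.End ℂ (Config L → ℂ)) = (if z * w = 1 then 2 * L * (1 - p * q) else 0) • 1 := by
  have hXX := fourierX_anticommutator hz hw
  have hYY := fourierY_anticommutator hz hw
  simp only [modeOperator, mul_add, add_mul, smul_mul_assoc, mul_smul_comm,
    fourierX_mul_fourierY hz hw, fourierX_mul_fourierY hw hz]
  calc _ = (fourierX z * fourierX w + fourierX w * fourierX z)
        + (p * q) • (fourierY z * fourierY w + fourierY w * fourierY z) := by module
    _ = _ := by
      rw [hXX, hYY]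
      split_ifs <;> module

lemma modeOperator_comm_of_phase_mul_eq_one (hz : z ∈ negOneRoots L) (hw : w ∈ negOneRoots L)
    (hpq : z * w = 1 → p * q = 1) :
    (modeOperator p z * modeOperator q w : Module.End ℂ (Config L → ℂ)) =
      -(modeOperator q w * modeOperator p z) := by
  refine eq_neg_of_add_eq_zero_left ?_
  rw [modeOperator_anticommutator hz hw]
  split_ifs with h
  · rw [hpq h, sub_self, mul_zero, zero_smul]
  · rw [zero_smul]

lemma modeOperator_number_add_number_inv (hz : z ∈ negOneRoots L) (hp : ‖p‖ = 1) :
    (modeOperator (-starRingEnd ℂ p) z⁻¹ * modeOperator p z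
      + modeOperator (-p) z * modeOperator (starRingEnd ℂ p) z⁻¹ : Module.End ℂ (Config L → ℂ)) =
    (4 * L : ℂ) • 1 - (2 * p) • (fourierY z * fourierX z⁻¹)
      - (2 * starRingEnd ℂ p) • (fourierY z⁻¹ * fourierX z) := by
  have hz' := inv_mem_negOneRoots hz
  have hp' : starRingEnd ℂ p * p = 1 := by rw [Complex.conj_mul', hp, Complex.ofReal_one, one_pow]
  have hinv : z⁻¹ * z = 1 := inv_mul_cancel₀ (ne_zero_of_mem_negOneRoots hz)
  have hXX := fourierX_anticommutator hz' hz
  have hYY := fourierY_anticommutator hz' hz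
  rw [if_pos hinv] at hXX hYY
  simp only [modeOperator, mul_add, add_mul, smul_mul_assoc, mul_smul_comm,
    fourierX_mul_fourierY hz' hz, fourierX_mul_fourierY hz hz']
  calc _ = (fourierX z⁻¹ * fourierX z + fourierX z * fourierX z⁻¹)
        - (starRingEnd ℂ p * p) • (fourierY z⁻¹ * fourierY z + fourierY z * fourierY z⁻¹)
        - (2 * p) • (fourierY z * fourierX z⁻¹)
        - (2 * starRingEnd ℂ p) • (fourierY z⁻¹ * fourierX z) := by module
    _ = _ := by rw [hXX, hYY, hp']; module

lemma norm_symbol_smul_number_add_inv (hh : 0 ≤ h) (ha : 0 < a) (hb : 0 < b) {z : ℂ}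
    (hz : z ∈ negOneRoots L) (v : Config L → ℂ) :
    (‖symbol h a b z‖ : ℂ) •
        modeOperator (-starRingEnd ℂ (phase h a b z)) z⁻¹ (bogoliubov h a b z v) +
      (‖symbol h a b z⁻¹‖ : ℂ) •
        modeOperator (-starRingEnd ℂ (phase h a b z⁻¹)) z⁻¹⁻¹ (bogoliubov h a b z⁻¹ v) =
    (4 * L * ‖symbol h a b z‖ : ℂ) • v
      - (2 * symbol h a b z) • fourierY z⁻¹ (fourierX z v)
      - (2 * symbol h a b z⁻¹) • fourierY z⁻¹⁻¹ (fourierX z⁻¹ v) := by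
  have hz₁ := norm_of_mem_negOneRoots hz
  have hσ := symbol_ne_zero_of_mem_negOneRoots hh ha hb hz
  have hop := LinearMap.congr_fun (modeOperator_number_add_number_inv hz (norm_phase hσ)) v
  have hphase := norm_symbol_mul_conj_phase hσ
  have hphase' := congrArg (starRingEnd ℂ) hphase
  rw [map_mul, Complex.conj_conj, Complex.conj_ofReal, conj_symbol h a b hz₁] at hphase'
  simp only [bogoliubov, norm_symbol_inv h a b hz₁, phase_inv h a b hz₁,
    Complex.conj_conj, inv_inv]
  simp only [LinearMap.add_apply, Module.End.mul_apply, LinearMap.sub_apply,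
    LinearMap.smul_apply, Module.End.one_apply] at hop
  rw [← smul_add, hop]
  match_scalars
  · ring
  · linear_combination -2 * hphase'
  · linear_combination -2 * hphase

lemma sum_norm_symbol_smul_number_eq (hL : 2 ≤ L) (hh : 0 ≤ h) (ha : 0 < a) (hb : 0 < b)
    {v : Config L → ℂ} (hv : IsEvenVec v) :
    ∑ z ∈ negOneRoots L, (‖symbol h a b z‖ : ℂ) •
      modeOperator (-starRingEnd ℂ (phase h a b z)) z⁻¹ (bogoliubov h a b z v) =
    (4 * L : ℂ) • ((topEnergy L h a b : ℂ) • v - xyHamiltonian h a b v) := by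
  set N : ℂ → Config L → ℂ := fun z => (‖symbol h a b z‖ : ℂ) •
    modeOperator (-starRingEnd ℂ (phase h a b z)) z⁻¹ (bogoliubov h a b z v) with hN
  set F : ℂ → Config L → ℂ := fun z => (symbol h a b z / 2) • fourierY z⁻¹ (fourierX z v)
  have hpair : ∀ z ∈ negOneRoots L, N z + N z⁻¹ =
      (4 * L * ‖symbol h a b z‖ : ℂ) • v - (4 : ℂ) • F z - (4 : ℂ) • F z⁻¹ := by
    intro z hz
    rw [hN, norm_symbol_smul_number_add_inv hh ha hb hz v]
    module
  have hsum : (2 : ℂ) • ∑ z ∈ negOneRoots L, N z = (2 : ℂ) •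
      ((4 * L : ℂ) • ((topEnergy L h a b : ℂ) • v - xyHamiltonian h a b v)) := by
    calc _ = ∑ z ∈ negOneRoots L, (N z + N z⁻¹) := by
          rw [Finset.sum_add_distrib, sum_negOneRoots_inv, two_smul]
      _ = (4 * L * ∑ z ∈ negOneRoots L, (‖symbol h a b z‖ : ℂ)) • v
          - (8 : ℂ) • ∑ z ∈ negOneRoots L, F z := by
          rw [Finset.sum_congr rfl hpair, Finset.sum_sub_distrib, Finset.sum_sub_distrib,
            ← Finset.sum_smul, ← Finset.smul_sum, ← Finset.smul_sum,
            sum_negOneRoots_inv, ← Finset.mul_sum]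
          module
      _ = _ := by
          rw [← smul_xyHamiltonian_eq_sum_symbol hL h a b hv, topEnergy]
          push_cast
          module
  exact smul_right_injective _ (two_ne_zero' ℂ) hsum

lemma xyHamiltonian_eq_of_bogoliubov_eq_zero (hL : 2 ≤ L) (hh : 0 ≤ h) (ha : 0 < a) (hb : 0 < b)
    {v : Config L → ℂ} (hv : IsEvenVec v) (hB : ∀ z ∈ negOneRoots L, bogoliubov h a b z v = 0) :
    xyHamiltonian h a b v = (topEnergy L h a b : ℂ) • v := by
  have hsum := sum_norm_symbol_smul_number_eq hL hh ha hb hv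
  have hL₀ : (4 * L : ℂ) ≠ 0 := mul_ne_zero (by norm_num) (NeZero.ne (L : ℂ))
  rw [Finset.sum_eq_zero fun z hz => by rw [hB z hz, map_zero, smul_zero], eq_comm,
    smul_eq_zero_iff_right hL₀, sub_eq_zero] at hsum
  exact hsum.symm

open scoped Matrix

lemma star_dotProduct_self {ι : Type*} [Fintype ι] (v : ι → ℂ) :
    star v ⬝ᵥ v = ((∑ i, ‖v i‖ ^ 2 : ℝ) : ℂ) := by
  push_cast
  exact Finset.sum_congr rfl fun i _ => Complex.conj_mul' _

lemma star_dotProduct_majorana {n i : ℕ} (hn : n < L) (hi : i ≤ L) (f g : Config L → ℂ) :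
    star f ⬝ᵥ majorana n i g = (if n < i then -1 else 1) * (star (majorana n i f) ⬝ᵥ g) := by
  rw [dotProduct, dotProduct, Finset.mul_sum]
  have hinv : Function.Involutive (siteFlip (L := L) n) := siteFlip_siteFlip n
  refine Fintype.sum_bijective _ hinv.bijective _ _ fun η => ?_
  rw [Pi.star_apply, Pi.star_apply, majorana_apply, majorana_apply,
    siteFlip_siteFlip, jwSign_siteFlip hn hi, star_mul', star_mul', star_jwSign]
  split_ifs <;> simp <;> ring

lemma star_dotProduct_fourierSum {A : ℕ → Module.End ℂ (Config L → ℂ)} {c : ℂ}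
    (hA : ∀ n < L, ∀ f g, star f ⬝ᵥ A n g = c * (star (A n f) ⬝ᵥ g)) (hz : ‖z‖ = 1)
    (f g : Config L → ℂ) :
    star f ⬝ᵥ fourierSum L A z⁻¹ g = c * (star (fourierSum L A z f) ⬝ᵥ g) := by
  rw [fourierSum_apply, fourierSum_apply, fourierSum, fourierSum, dotProduct_sum, star_sum,
    sum_dotProduct, Finset.mul_sum]
  refine Finset.sum_congr rfl fun n hn => ?_
  rw [dotProduct_smul, hA n (Finset.mem_range.mp hn), star_smul, smul_dotProduct, star_pow,
    Complex.inv_eq_conj hz, smul_eq_mul, smul_eq_mul, mul_left_comm]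
  rfl

lemma star_dotProduct_modeOperator (hz : ‖z‖ = 1) (p : ℂ) (f g : Config L → ℂ) :
    star f ⬝ᵥ modeOperator (-starRingEnd ℂ p) z⁻¹ g = star (modeOperator p z f) ⬝ᵥ g := by
  have hX : star f ⬝ᵥ fourierX z⁻¹ g = 1 * (star (fourierX z f) ⬝ᵥ g) :=
    star_dotProduct_fourierSum (fun n hn f g => by
      rw [star_dotProduct_majorana hn hn.le, if_neg (lt_irrefl n)]) hz f g
  have hY : star f ⬝ᵥ fourierY z⁻¹ g = -1 * (star (fourierY z f) ⬝ᵥ g) :=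
    star_dotProduct_fourierSum (fun n hn f g => by
      rw [star_dotProduct_majorana hn hn, if_pos n.lt_succ_self]) hz f g
  simp only [modeOperator, LinearMap.add_apply, LinearMap.smul_apply, dotProduct_add, star_add,
    add_dotProduct, dotProduct_smul, star_smul, smul_dotProduct, hX, hY, smul_eq_mul]
  simp

lemma re_star_dotProduct_xyHamiltonian (hL : 2 ≤ L) (hh : 0 ≤ h) (ha : 0 < a) (hb : 0 < b)
    {v : Config L → ℂ} (hv : IsEvenVec v) :
    4 * L * (star v ⬝ᵥ xyHamiltonian h a b v).re = 4 * L * (topEnergy L h a b * ∑ η, ‖v η‖ ^ 2)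
      - ∑ z ∈ negOneRoots L, ‖symbol h a b z‖ * ∑ η, ‖bogoliubov h a b z v η‖ ^ 2 := by
  have hsum := congrArg (star v ⬝ᵥ ·) (sum_norm_symbol_smul_number_eq hL hh ha hb hv)
  simp only [dotProduct_sum, dotProduct_smul, dotProduct_sub, star_dotProduct_self,
    smul_eq_mul] at hsum
  rw [Finset.sum_congr rfl fun z hz => by
    rw [star_dotProduct_modeOperator (norm_of_mem_negOneRoots hz), star_dotProduct_self]] at hsum
  have hre := congrArg Complex.re hsum
  norm_cast at hre
  rw [show ((4 * L : ℕ) : ℂ) = ((4 * L : ℝ) : ℂ) by push_cast; rfl, Complex.re_ofReal_mul,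
    Complex.sub_re, Complex.ofReal_re] at hre
  linear_combination hre

lemma bogoliubov_eq_zero_of_topEnergy_le (hL : 2 ≤ L) (hh : 0 ≤ h) (ha : 0 < a) (hb : 0 < b)
    {v : Config L → ℂ} (hv : IsEvenVec v)
    (hle : topEnergy L h a b * ∑ η, ‖v η‖ ^ 2 ≤ (star v ⬝ᵥ xyHamiltonian h a b v).re)
    (hz : z ∈ negOneRoots L) : bogoliubov h a b z v = 0 := by
  have henergy := re_star_dotProduct_xyHamiltonian hL hh ha hb hv
  have hnonpos : ∑ z ∈ negOneRoots L, ‖symbol h a b z‖ *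
      ∑ η, ‖bogoliubov h a b z v η‖ ^ 2 ≤ 0 := by
    have := mul_le_mul_of_nonneg_left hle (by positivity : (0 : ℝ) ≤ 4 * L)
    linarith
  have hterm := (Finset.sum_eq_zero_iff_of_nonneg fun z _ => by positivity).mp
    (hnonpos.antisymm (Finset.sum_nonneg fun z _ => by positivity)) z hz
  have hnorm := (mul_eq_zero.mp hterm).resolve_left
    (norm_ne_zero_iff.mpr (symbol_ne_zero_of_mem_negOneRoots hh ha hb hz))
  funext η
  simpa using (Finset.sum_eq_zero_iff_of_nonneg fun η _ => by positivity).mp hnorm η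
    (Finset.mem_univ η)

lemma re_star_dotProduct_xyHamiltonian_le_norm (h : ℝ) (ha : 0 ≤ a) (hb : 0 ≤ b)
    (v : Config L → ℂ) :
    (star v ⬝ᵥ xyHamiltonian h a b v).re ≤
      (star (fun η => (‖v η‖ : ℂ)) ⬝ᵥ xyHamiltonian h a b fun η => ‖v η‖).re := by
  simp only [dotProduct, xyHamiltonian, Complex.re_sum, Finset.mul_sum, Pi.star_apply]
  refine Finset.sum_le_sum fun η _ => Finset.sum_le_sum fun k _ => ?_
  obtain ⟨r, hr₀, hr⟩ : ∃ r : ℝ, 0 ≤ r ∧ (if η k = η (k + 1) then (b : ℂ) else a) = r := by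
    split_ifs
    exacts [⟨b, hb, rfl⟩, ⟨a, ha, rfl⟩]
  obtain ⟨s, hs⟩ : ∃ s : ℝ, spin (η k) = s := by
    cases η k
    exacts [⟨1, by simp [spin]⟩, ⟨-1, by simp [spin]⟩]
  have hdiag : ∀ c : ℂ, star c * (r * v (flip η k) + h * s * c) =
      r * (star c * v (flip η k)) + ((h * s * ‖c‖ ^ 2 : ℝ) : ℂ) := fun c => by
    have := Complex.conj_mul' c
    rw [Complex.star_def]
    push_cast
    linear_combination (h * s : ℂ) * this
  have hdiag' : star (‖v η‖ : ℂ) * (r * ‖v (flip η k)‖ + h * s * ‖v η‖) =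
      ((r * (‖v η‖ * ‖v (flip η k)‖) + h * s * ‖v η‖ ^ 2 : ℝ) : ℂ) := by
    rw [Complex.star_def, Complex.conj_ofReal]
    push_cast
    ring
  rw [hr, hs, hdiag, hdiag', Complex.add_re, Complex.re_ofReal_mul, Complex.ofReal_re,
    Complex.ofReal_re]
  have hcauchy : (star (v η) * v (flip η k)).re ≤ ‖v η‖ * ‖v (flip η k)‖ :=
    (Complex.re_le_norm _).trans (by rw [norm_mul, norm_star])
  gcongr

lemma xyHamiltonian_norm_eq (hL : 2 ≤ L) (hh : 0 ≤ h) (ha : 0 < a) (hb : 0 < b)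
    {v : Config L → ℂ} (hv : IsEvenVec v)
    (htop : xyHamiltonian h a b v = (topEnergy L h a b : ℂ) • v) :
    xyHamiltonian h a b (fun η => (‖v η‖ : ℂ)) =
      (topEnergy L h a b : ℂ) • fun η => (‖v η‖ : ℂ) := by
  have heven : IsEvenVec fun η => (‖v η‖ : ℂ) := fun η hη => by simp [hv η hη]
  refine xyHamiltonian_eq_of_bogoliubov_eq_zero hL hh ha hb heven fun z =>
    bogoliubov_eq_zero_of_topEnergy_le hL hh ha hb heven ?_
  refine le_trans (le_of_eq ?_) (re_star_dotProduct_xyHamiltonian_le_norm h ha.le hb.le v)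
  simp only [htop, dotProduct_smul, star_dotProduct_self, Complex.norm_real, norm_norm]
  rw [smul_eq_mul, ← Complex.ofReal_mul, Complex.ofReal_re]

end Bogoliubov

section GroundState

/-! ### Positivity of the ground state -/

variable {L : ℕ} {h a b : ℝ} {p z w : ℂ} {v : Config L → ℂ}

/-- The configuration without particles, the vacuum of the particle annihilation operators. -/
def emptyConfig (L : ℕ) : Config L := fun _ => false

lemma jwSign_emptyConfig (n : ℕ) : jwSign (emptyConfig L) n = 1 := by
  simp [jwSign, emptyConfig, spin]

lemma modeOperator_apply_emptyConfig (p z : ℂ) (v : Config L → ℂ) :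
    modeOperator p z v (emptyConfig L) = (1 + p) / 2 * modeOperator 1 z v (emptyConfig L) := by
  simp only [modeOperator_apply, jwSign_emptyConfig, Finset.mul_sum]
  exact Finset.sum_congr rfl fun n _ => by ring

lemma modeOperator_one_single_emptyConfig [DecidableEq (Config L)] (z : ℂ) :
    modeOperator 1 z (Pi.single (emptyConfig L) 1 : Config L → ℂ) = 0 := by
  funext η
  rw [modeOperator_apply]
  refine Finset.sum_eq_zero fun n _ => ?_
  cases hη : η (n : ZMod L)
  · have hne : siteFlip n η ≠ emptyConfig L := fun heq => by
      have := congrFun heq (n : ZMod L)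
      simp [siteFlip, emptyConfig, hη] at this
    rw [Pi.single_eq_of_ne hne, mul_zero]
  · rw [jwSign_succ, hη, spin, if_pos rfl]
    ring

lemma isEvenVec_single_emptyConfig [DecidableEq (Config L)] :
    IsEvenVec (Pi.single (emptyConfig L) 1 : Config L → ℂ) := by
  intro η hη
  refine Pi.single_eq_of_ne ?_ 1
  rintro rfl
  rw [jwSign_emptyConfig] at hη
  norm_num at hη

lemma IsEvenVec.modeOperator_modeOperator (hv : IsEvenVec v) (p z q w : ℂ) :
    IsEvenVec (modeOperator p z (modeOperator q w v)) := by
  intro η hη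
  rw [modeOperator_apply]
  refine Finset.sum_eq_zero fun m hm => ?_
  rw [modeOperator_apply, Finset.sum_eq_zero fun n hn => ?_, mul_zero]
  rw [hv _ (by rw [jwSign_siteFlip_self (Finset.mem_range.mp hn),
    jwSign_siteFlip_self (Finset.mem_range.mp hm), neg_neg, hη]), mul_zero]

lemma im_phase (h a b : ℝ) (hz : ‖z‖ = 1) :
    (phase h a b z).im = -(2 * b * z.im) / ‖symbol h a b z‖ := by
  rw [phase, Complex.div_ofReal_im, Complex.conj_im, symbol_im h a b hz]

lemma phase_neg_one (hh : 0 ≤ h) (ha : 0 < a) : phase h a b (-1) = 1 := by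
  have hpos : 0 < 2 * (h + a) := by positivity
  rw [phase, symbol_neg_one, Complex.conj_ofReal, Complex.norm_real, Real.norm_of_nonneg hpos.le,
    div_self (Complex.ofReal_ne_zero.mpr hpos.ne')]

lemma exists_mem_forall_lt_eq_false (hL : 2 ≤ L) {Z : Set (Config L)}
    (hZ : ∀ η ∈ Z, ∀ k, flip η k ∈ Z) {η : Config L} (hη : η ∈ Z) (heven : jwSign η L = 1)
    {n : ℕ} (hn : n < L) :
    ∃ ξ ∈ Z, jwSign ξ L = 1 ∧ ∀ m < n, ξ (m : ZMod L) = false := by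
  induction n with
  | zero => exact ⟨η, hη, heven, fun m hm => absurd hm (Nat.not_lt_zero m)⟩
  | succ n ih =>
    obtain ⟨ξ, hξ, hξeven, hfalse⟩ := ih (by omega)
    cases hn' : ξ (n : ZMod L)
    · refine ⟨ξ, hξ, hξeven, fun m hm => ?_⟩
      rcases Nat.lt_succ_iff_lt_or_eq.mp hm with hm | rfl
      exacts [hfalse m hm, hn']
    · refine ⟨flip ξ n, hZ ξ hξ _, ?_, fun m hm => ?_⟩
      · rw [flip_natCast hL, jwSign_siteFlip_self hn, jwSign_siteFlip_self (by omega), hξeven,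
          neg_neg]
      · have hne : (m : ZMod L) ≠ ((n + 1 : ℕ) : ZMod L) := by
          rw [Ne, natCast_zmod_inj (by omega) hn]
          omega
        rw [flip_natCast hL, siteFlip, Function.update_of_ne hne, siteFlip]
        rcases Nat.lt_succ_iff_lt_or_eq.mp hm with hm | rfl
        · have hne' : (m : ZMod L) ≠ (n : ZMod L) := by
            rw [Ne, natCast_zmod_inj (by omega) (by omega)]
            omega
          rw [Function.update_of_ne hne', hfalse m hm]
        · rw [Function.update_self, hn', Bool.not_true]

variable [NeZero L]

lemma phase_mul_phase (hh : 0 ≤ h) (ha : 0 < a) (hb : 0 < b) (hz : z ∈ negOneRoots L)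
    (hzw : z * w = 1) : phase h a b z * phase h a b w = 1 := by
  rw [eq_inv_of_mul_eq_one_right hzw, phase_inv h a b (norm_of_mem_negOneRoots hz),
    Complex.mul_conj', norm_phase (symbol_ne_zero_of_mem_negOneRoots hh ha hb hz),
    Complex.ofReal_one, one_pow]

lemma modeOperator_bogoliubov_bogoliubov (hz : z ∈ negOneRoots L) (hw : w ∈ negOneRoots L)
    (hzw : z * w = 1 → p * phase h a b w = 1) (hzw' : z * w⁻¹ = 1 → p * phase h a b w⁻¹ = 1) :
    modeOperator p z (bogoliubov h a b w⁻¹ (bogoliubov h a b w v)) =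
      bogoliubov h a b w⁻¹ (bogoliubov h a b w (modeOperator p z v)) := by
  rw [← Module.End.mul_apply,
    modeOperator_comm_of_phase_mul_eq_one hz (inv_mem_negOneRoots hw) hzw', LinearMap.neg_apply,
    Module.End.mul_apply, ← Module.End.mul_apply (modeOperator p z),
    modeOperator_comm_of_phase_mul_eq_one hz hw hzw, LinearMap.neg_apply, map_neg, neg_neg,
    Module.End.mul_apply]

lemma bogoliubov_bogoliubov_self (hh : 0 ≤ h) (ha : 0 < a) (hb : 0 < b) (hz : z ∈ negOneRoots L)
    (v : Config L → ℂ) : bogoliubov h a b z (bogoliubov h a b z v) = 0 :=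
  self_eq_neg.mp <| LinearMap.congr_fun (modeOperator_comm_of_phase_mul_eq_one hz hz
    fun hzz => phase_mul_phase hh ha hb hz hzz) v

lemma bogoliubov_bogoliubov_bogoliubov_eq_zero (hh : 0 ≤ h) (ha : 0 < a) (hb : 0 < b)
    (hz : z ∈ negOneRoots L) (hw : w ∈ negOneRoots L)
    (hker : z = w ∨ z = w⁻¹ ∨ bogoliubov h a b z v = 0) :
    bogoliubov h a b z (bogoliubov h a b w⁻¹ (bogoliubov h a b w v)) = 0 := by
  have hcomm := modeOperator_bogoliubov_bogoliubov (v := v) hz hw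
    (phase_mul_phase hh ha hb hz) (phase_mul_phase (h := h) (a := a) (b := b) hh ha hb hz)
  rcases hker with rfl | rfl | hker
  · rw [hcomm, bogoliubov_bogoliubov_self hh ha hb hz, map_zero]
  · exact bogoliubov_bogoliubov_self hh ha hb hz _
  · rw [hcomm, hker, map_zero, map_zero]

lemma bogoliubov_inv_bogoliubov_apply_emptyConfig (hw : w ∈ negOneRoots L)
    (hv : modeOperator 1 w⁻¹ v = 0) :
    bogoliubov h a b w⁻¹ (bogoliubov h a b w v) (emptyConfig L) =
      L * (1 + phase h a b w⁻¹) * (1 - phase h a b w) * v (emptyConfig L) := by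
  have hanti := LinearMap.congr_fun (modeOperator_anticommutator (p := 1) (q := phase h a b w)
    (inv_mem_negOneRoots hw) hw) v
  rw [if_pos (inv_mul_cancel₀ (ne_zero_of_mem_negOneRoots hw)), LinearMap.add_apply,
    Module.End.mul_apply, Module.End.mul_apply, hv, map_zero, add_zero] at hanti
  rw [modeOperator_apply_emptyConfig, hanti, LinearMap.smul_apply, Module.End.one_apply,
    Pi.smul_apply, smul_eq_mul]
  ring

lemma im_phase_ne_zero (hh : 0 ≤ h) (ha : 0 < a) (hb : 0 < b) (hz : z ∈ negOneRoots L)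
    (him : z.im ≠ 0) : (phase h a b z).im ≠ 0 := by
  rw [im_phase h a b (norm_of_mem_negOneRoots hz)]
  exact div_ne_zero (neg_ne_zero.mpr (mul_ne_zero (by positivity) him))
    (norm_ne_zero_iff.mpr (symbol_ne_zero_of_mem_negOneRoots hh ha hb hz))

/-- Filling the modes `w` and `w⁻¹` of the vacuum, one pair after the other, produces the BCS
ground state. -/
lemma exists_isEvenVec_bogoliubov_eq_zero_of_mem (hh : 0 ≤ h) (ha : 0 < a) (hb : 0 < b)
    (S : Finset ℂ) (hS : ∀ z ∈ S, z ∈ negOneRoots L ∧ 0 < z.im) :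
    ∃ ψ : Config L → ℂ, IsEvenVec ψ ∧ ψ (emptyConfig L) ≠ 0 ∧
      (∀ z ∈ negOneRoots L, z ∈ S ∨ z⁻¹ ∈ S → bogoliubov h a b z ψ = 0) ∧
      ∀ z ∈ negOneRoots L, z ∉ S → z⁻¹ ∉ S → modeOperator 1 z ψ = 0 := by
  classical
  induction S using Finset.induction with
  | empty =>
    exact ⟨Pi.single (emptyConfig L) 1, isEvenVec_single_emptyConfig, by simp, by simp,
      fun z _ _ _ => modeOperator_one_single_emptyConfig z⟩
  | insert w S hwS ih =>
    obtain ⟨hw, him⟩ := hS w (Finset.mem_insert_self w S)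
    have hS' : ∀ z ∈ S, z ∈ negOneRoots L ∧ 0 < z.im := fun z hz =>
      hS z (Finset.mem_insert_of_mem hz)
    obtain ⟨ψ, heven, hne, hbog, hann⟩ := ih hS'
    have hwinv : w⁻¹ ∉ S := fun hmem => by
      have := (hS' _ hmem).2
      rw [Complex.inv_eq_conj (norm_of_mem_negOneRoots hw), Complex.conj_im] at this
      linarith
    refine ⟨bogoliubov h a b w⁻¹ (bogoliubov h a b w ψ), heven.modeOperator_modeOperator _ _ _ _,
      ?_, fun z hz hzS => ?_, fun z hz hzS hzS' => ?_⟩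
    · rw [bogoliubov_inv_bogoliubov_apply_emptyConfig hw
        (hann _ (inv_mem_negOneRoots hw) hwinv (by rwa [inv_inv])),
        phase_inv h a b (norm_of_mem_negOneRoots hw)]
      have hphase := im_phase_ne_zero hh ha hb hw him.ne'
      refine mul_ne_zero (mul_ne_zero (mul_ne_zero (NeZero.ne _) ?_) ?_) hne <;>
        exact fun heq => hphase (by simpa using congrArg Complex.im heq)
    · refine bogoliubov_bogoliubov_bogoliubov_eq_zero hh ha hb hz hw ?_
      simp only [Finset.mem_insert, inv_eq_iff_eq_inv] at hzS
      rcases hzS with (rfl | hzS) | (rfl | hzS)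
      exacts [.inl rfl, .inr (.inr (hbog z hz (.inl hzS))), .inr (.inl rfl),
        .inr (.inr (hbog z hz (.inr hzS)))]
    · rw [Finset.mem_insert, not_or] at hzS hzS'
      rw [modeOperator_bogoliubov_bogoliubov hz hw
        (fun heq => absurd (eq_inv_of_mul_eq_one_right heq).symm hzS'.1)
        (fun heq => absurd (eq_of_mul_inv_eq_one heq) hzS.1), hann z hz hzS.2 hzS'.2, map_zero,
        map_zero]

lemma exists_isEvenVec_bogoliubov_eq_zero (hh : 0 ≤ h) (ha : 0 < a) (hb : 0 < b) :
    ∃ ψ : Config L → ℂ, IsEvenVec ψ ∧ ψ (emptyConfig L) ≠ 0 ∧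
      ∀ z ∈ negOneRoots L, bogoliubov h a b z ψ = 0 := by
  obtain ⟨ψ, heven, hne, hbog, hann⟩ := exists_isEvenVec_bogoliubov_eq_zero_of_mem hh ha hb
    ((negOneRoots L).filter fun z => 0 < z.im) fun z hz => Finset.mem_filter.mp hz
  refine ⟨ψ, heven, hne, fun z hz => ?_⟩
  have hinv : z⁻¹.im = -z.im := by
    rw [Complex.inv_eq_conj (norm_of_mem_negOneRoots hz), Complex.conj_im]
  rcases lt_trichotomy z.im 0 with him | him | him
  · exact hbog z hz (.inr (Finset.mem_filter.mpr ⟨inv_mem_negOneRoots hz, by linarith⟩))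
  · have hz₁ : z = -1 := by
      refine (eq_one_or_neg_one_of_norm_eq_one (norm_of_mem_negOneRoots hz) him).resolve_left ?_
      rintro rfl
      have := mem_negOneRoots.mp hz
      norm_num at this
    have hann_z := hann z hz (fun hmem => (Finset.mem_filter.mp hmem).2.ne' him)
      (fun hmem => (Finset.mem_filter.mp hmem).2.ne' (by rw [hinv, him, neg_zero]))
    rwa [← phase_neg_one hh ha (b := b), ← hz₁] at hann_z
  · exact hbog z hz (.inl (Finset.mem_filter.mpr ⟨hz, him⟩))

lemma eq_emptyConfig_of_forall_lt {ξ : Config L} (heven : jwSign ξ L = 1)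
    (hfalse : ∀ m < L - 1, ξ (m : ZMod L) = false) : ξ = emptyConfig L := by
  have hpos : 0 < L := NeZero.pos L
  have hlast : ξ ((L - 1 : ℕ) : ZMod L) = false := by
    have hsucc : jwSign ξ (L - 1 + 1) = 1 := by rwa [Nat.sub_add_cancel hpos]
    rw [jwSign_succ, jwSign, Finset.prod_eq_one fun m hm => by
      rw [hfalse m (Finset.mem_range.mp hm)]; rfl, one_mul] at hsucc
    by_contra hne
    rw [Bool.not_eq_false] at hne
    norm_num [spin, hne] at hsucc
  funext k
  have hk := ZMod.val_lt k
  rw [← ZMod.natCast_zmod_val k]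
  obtain hlt | heq : k.val < L - 1 ∨ k.val = L - 1 := by omega
  · exact hfalse _ hlt
  · rw [heq]
    exact hlast

lemma emptyConfig_mem_of_flip_mem (hL : 2 ≤ L) {Z : Set (Config L)}
    (hZ : ∀ η ∈ Z, ∀ k, flip η k ∈ Z) {η : Config L} (hη : η ∈ Z) (heven : jwSign η L = 1) :
    emptyConfig L ∈ Z := by
  obtain ⟨ξ, hξ, hξeven, hfalse⟩ :=
    exists_mem_forall_lt_eq_false hL hZ hη heven (Nat.sub_lt (NeZero.pos L) one_pos)
  exact eq_emptyConfig_of_forall_lt hξeven hfalse ▸ hξ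

lemma exists_pos_xyHamiltonian_eigenfunction (hL : 2 ≤ L) (hh : 0 ≤ h) (ha : 0 < a) (hb : 0 < b) :
    ∃ φ : Config L → ℝ, (∀ η, jwSign η L = 1 → 0 < φ η) ∧
      ∀ η, ∑ k : ZMod L, ((if η k = η (k + 1) then b else a) * φ (flip η k)
        + h * (1 - 2 * occ η k) * φ η) = topEnergy L h a b * φ η := by
  obtain ⟨ψ, heven, hne, hbog⟩ := exists_isEvenVec_bogoliubov_eq_zero (L := L) hh ha hb
  have hnorm := xyHamiltonian_norm_eq hL hh ha hb heven
    (xyHamiltonian_eq_of_bogoliubov_eq_zero hL hh ha hb heven hbog)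
  have heigen : ∀ η, ∑ k : ZMod L, ((if η k = η (k + 1) then b else a) * ‖ψ (flip η k)‖
      + h * (1 - 2 * occ η k) * ‖ψ η‖) = topEnergy L h a b * ‖ψ η‖ := fun η => by
    apply Complex.ofReal_injective
    have hη := congrFun hnorm η
    rw [xyHamiltonian, Pi.smul_apply, smul_eq_mul] at hη
    push_cast
    rw [← hη]
    refine Finset.sum_congr rfl fun k _ => ?_
    congr 1
    · split_ifs <;> rfl
    · rw [occ, spin]
      split_ifs <;> push_cast <;> ring
  refine ⟨fun η => ‖ψ η‖, fun η hη => norm_pos_iff.mpr fun hzero => hne ?_, heigen⟩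
  -- A nonnegative eigenfunction that vanishes at a configuration also vanishes at its neighbours.
  refine emptyConfig_mem_of_flip_mem hL (Z := {ξ | ψ ξ = 0}) (fun ξ hξ k => ?_) hzero hη
  have hsum := heigen ξ
  rw [Set.mem_ofPred_eq.mp hξ] at hsum
  simp only [norm_zero, mul_zero, add_zero] at hsum
  have hterm := (Finset.sum_eq_zero_iff_of_nonneg fun k _ => by
    split_ifs <;> positivity).mp hsum k (Finset.mem_univ k)
  have hrate : (if ξ k = ξ (k + 1) then b else a) ≠ 0 := by split_ifs <;> positivity
  exact norm_eq_zero.mp ((mul_eq_zero.mp hterm).resolve_left hrate)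

end GroundState

section CumulantGeneratingFunction

/-! ### The limiting cumulant generating function -/

variable {L : ℕ} {w μ g x : ℝ}

/-- The square of half the modulus of the symbol for the parameters of the process, as a function
of `x = exp s` and of the momentum `q`. -/
def dispersionSq (w μ x q : ℝ) : ℝ :=
  μ ^ 2 + 2 * μ * w * (x - Real.cos q) + w ^ 2 * (1 - x * Real.cos q) ^ 2

/-- The limiting cumulant generating function of the activity in the even sector. -/
def activityCGF (w μ : ℝ) (L : ℕ) (s : ℝ) : ℝ :=
  1 / L * ∑ j ∈ Finset.range L, Real.sqrt (dispersionSq w μ (Real.exp s) (momentum L j)) - (μ + w)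

/-- The derivative of the cumulant generating function with respect to `s`, written as a function
of `x = exp s` so that the limit `s → -∞` becomes the value at `x = 0`. -/
def meanActivity (w μ : ℝ) (L : ℕ) (x : ℝ) : ℝ :=
  1 / L * ∑ j ∈ Finset.range L,
    x * w * (μ - w * Real.cos (momentum L j) * (1 - x * Real.cos (momentum L j))) /
      Real.sqrt (dispersionSq w μ x (momentum L j))

lemma norm_symbol_cexp (hμ : 0 ≤ μ) (hw : 0 ≤ w) (hx : 0 ≤ x) (q : ℝ) :
    ‖symbol w (μ + w * x) (Real.sqrt (μ * (μ + 2 * w * x))) (Complex.exp (q * Complex.I))‖ =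
      2 * Real.sqrt (dispersionSq w μ x q) := by
  have hz := Complex.norm_exp_ofReal_mul_I q
  have hsqrt := Real.sq_sqrt (by positivity : 0 ≤ μ * (μ + 2 * w * x))
  have htwo : (2 : ℝ) = Real.sqrt (2 ^ 2) := (Real.sqrt_sq zero_le_two).symm
  rw [← Real.sqrt_sq (norm_nonneg _), Complex.sq_norm, Complex.normSq_apply, symbol_re _ _ _ hz,
    symbol_im _ _ _ hz, Complex.exp_ofReal_mul_I_re, Complex.exp_ofReal_mul_I_im]
  conv_rhs => rw [htwo, ← Real.sqrt_mul (by positivity)]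
  congr 1
  rw [dispersionSq]
  linear_combination 4 * Real.sin q ^ 2 * hsqrt
    + 4 * μ * (μ + 2 * w * x) * Real.sin_sq_add_cos_sq q

lemma activityCGF_eq [NeZero L] (hμ : 0 ≤ μ) (hw : 0 ≤ w) (s : ℝ) :
    activityCGF w μ L s = (topEnergy L w (μ + w * Real.exp s)
      (Real.sqrt (μ * (μ + 2 * w * Real.exp s))) - L * (μ + w)) / L := by
  have : (L : ℝ) ≠ 0 := Nat.cast_ne_zero.mpr (NeZero.ne L)
  simp only [activityCGF, topEnergy, sum_negOneRoots, norm_symbol_cexp hμ hw (Real.exp_pos s).le,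
    ← Finset.mul_sum]
  field_simp

lemma dispersionSq_momentum_pos [NeZero L] (hμ : 0 < μ) (hw : 0 ≤ w) (hx : 0 ≤ x) (j : ℕ) :
    0 < dispersionSq w μ x (momentum L j) := by
  rw [← Real.sqrt_pos, ← mul_pos_iff_of_pos_left (zero_lt_two' ℝ), ← norm_symbol_cexp hμ.le hw hx,
    norm_pos_iff]
  exact symbol_ne_zero_of_mem_negOneRoots hw (by positivity) (Real.sqrt_pos.mpr (by positivity))
    (cexp_momentum_mem_negOneRoots L j)

lemma hasDerivAt_dispersionSq (w μ x q : ℝ) : HasDerivAt (fun x => dispersionSq w μ x q)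
    (2 * w * (μ - w * Real.cos q * (1 - x * Real.cos q))) x := by
  have hlin := ((hasDerivAt_id x).sub_const (Real.cos q)).const_mul (2 * μ * w)
  have hsq := ((((hasDerivAt_id x).mul_const (Real.cos q)).const_sub 1).pow 2).const_mul (w ^ 2)
  refine ((hlin.const_add (μ ^ 2)).add hsq).congr_deriv ?_
  simp only [id]
  push_cast
  ring

variable [NeZero L]

lemma hasDerivAt_activityCGF (hμ : 0 < μ) (hw : 0 ≤ w) (s : ℝ) :
    HasDerivAt (activityCGF w μ L) (meanActivity w μ L (Real.exp s)) s := by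
  refine ((HasDerivAt.fun_sum fun j _ => ?_).const_mul _).sub_const _
  have hD := (hasDerivAt_dispersionSq w μ _ (momentum L j)).comp s (Real.hasDerivAt_exp s)
  refine (hD.sqrt (dispersionSq_momentum_pos hμ hw (Real.exp_pos s).le j).ne').congr_deriv ?_
  rw [← mul_div_mul_left (Real.exp s * w * _) _ two_ne_zero]
  refine congrArg₂ _ ?_ rfl
  ring

lemma continuousAt_meanActivity (hμ : 0 < μ) (hw : 0 ≤ w) (hx : 0 ≤ x) :
    ContinuousAt (meanActivity w μ L) x := by
  refine continuousAt_const.mul (tendsto_finsetSum _ fun j _ => ContinuousAt.div ?_ ?_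
    (Real.sqrt_pos.mpr (dispersionSq_momentum_pos hμ hw hx j)).ne')
  · fun_prop
  · exact (hasDerivAt_dispersionSq w μ x _).continuousAt.sqrt

lemma tendsto_meanActivity_atBot (hμ : 0 < μ) (hw : 0 ≤ w) :
    Tendsto (fun s => meanActivity w μ L (Real.exp s)) atBot (𝓝 (meanActivity w μ L 0)) :=
  (continuousAt_meanActivity hμ hw le_rfl).tendsto.comp Real.tendsto_exp_atBot

lemma particleNumber_flip (hL : 2 ≤ L) (η : Config L) (k : ZMod L) :
    particleNumber (flip η k) + ((if η k then 1 else 0) + if η (k + 1) then 1 else 0) =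
      particleNumber η + ((if η k then 0 else 1) + if η (k + 1) then 0 else 1) := by
  have hne := add_one_ne_self hL k
  have hsite : ∀ i (c : ℕ), c = ∑ j : ZMod L, if j = i then c else 0 := fun i c => by simp
  rw [hsite k (if η k then 1 else 0), hsite (k + 1) (if η (k + 1) then 1 else 0),
    hsite k (if η k then 0 else 1), hsite (k + 1) (if η (k + 1) then 0 else 1), particleNumber,
    particleNumber]
  simp only [← Finset.sum_add_distrib]
  refine Finset.sum_congr rfl fun j _ => ?_
  rcases eq_or_ne j k with rfl | hj
  · cases hη : η j <;> simp [flip, hne.symm, hη]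
  rcases eq_or_ne j (k + 1) with rfl | hj'
  · cases hη : η (k + 1) <;> simp [flip, hne, hη]
  · simp [flip, hj, hj']

lemma even_particleNumber_flip (hL : 2 ≤ L) {η : Config L} (hη : Even (particleNumber η))
    (k : ZMod L) : Even (particleNumber (flip η k)) := by
  have := particleNumber_flip hL η k
  rw [Nat.even_iff] at hη ⊢
  split_ifs at this <;> omega

lemma jwSign_eq_neg_one_pow_particleNumber (η : Config L) :
    jwSign η L = (-1) ^ particleNumber η := by
  rw [jwSign, ← prod_zmod_eq_prod_range fun k => spin (η k), particleNumber,
    ← Finset.prod_pow_eq_pow_sum]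
  refine Finset.prod_congr rfl fun k _ => ?_
  cases η k <;> simp [spin]

lemma rate_mul_pow_particleNumber_flip {b : ℝ} (hL : 2 ≤ L) (hg : μ * g ^ 2 = b)
    (hg' : b * g ^ 2 = μ + 2 * w * x) (η : Config L) (k : ZMod L) :
    (μ + w * (occ η k + occ η (k + 1)) * x) * g ^ particleNumber (flip η k) =
      (if η k = η (k + 1) then b else μ + w * x) * g ^ particleNumber η := by
  have hN := particleNumber_flip hL η k
  rw [occ, occ]
  cases hk : η k <;> cases hk' : η (k + 1) <;>
    simp only [hk, hk', if_true, if_false, Bool.false_eq_true, reduceCtorEq] at hN ⊢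
  · rw [show particleNumber (flip η k) = particleNumber η + 2 by omega, pow_add, ← hg]
    ring
  · rw [show particleNumber (flip η k) = particleNumber η by omega]
    ring
  · rw [show particleNumber (flip η k) = particleNumber η by omega]
    ring
  · rw [show particleNumber η = particleNumber (flip η k) + 2 by omega, pow_add]
    linear_combination -g ^ particleNumber (flip η k) * hg'

lemma tiltedGenerator_pow_particleNumber_mul {b s : ℝ} (hL : 2 ≤ L) (hg : μ * g ^ 2 = b)
    (hg' : b * g ^ 2 = μ + 2 * w * Real.exp s) (φ : Config L → ℝ) (η : Config L) :
    tiltedGenerator w μ s L (fun ξ => g ^ particleNumber ξ * φ ξ) η =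
      g ^ particleNumber η * (∑ k : ZMod L,
        ((if η k = η (k + 1) then b else μ + w * Real.exp s) * φ (flip η k)
          + w * (1 - 2 * occ η k) * φ η) - L * (μ + w) * φ η) := by
  have hshift : ∑ k : ZMod L, occ η (k + 1) = ∑ k, occ η k :=
    Equiv.sum_comp (Equiv.addRight (1 : ZMod L)) (occ η)
  have hzero : ∑ k : ZMod L, w * (occ η k - occ η (k + 1)) * (g ^ particleNumber η * φ η) = 0 := by
    rw [← Finset.sum_mul, ← Finset.mul_sum, Finset.sum_sub_distrib, hshift, sub_self, mul_zero,
      zero_mul]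
  have hconst : L * (μ + w) * φ η = ∑ _k : ZMod L, (μ + w) * φ η := by
    rw [Finset.sum_const, Finset.card_univ, ZMod.card, nsmul_eq_mul, mul_assoc]
  rw [tiltedGenerator_apply, hconst, ← Finset.sum_sub_distrib, Finset.mul_sum, ← sub_eq_zero,
    ← Finset.sum_sub_distrib, ← hzero]
  refine Finset.sum_congr rfl fun k _ => ?_
  linear_combination φ (flip η k) * rate_mul_pow_particleNumber_flip hL hg hg' η k

lemma exists_pos_tiltedGenerator_eigenfunction (hL : 2 ≤ L) (hμ : 0 < μ) (hw : 0 ≤ w) (s : ℝ) :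
    ∃ φ : Config L → ℝ, (∀ η, Even (particleNumber η) → 0 < φ η) ∧
      ∀ η, tiltedGenerator w μ s L φ η = activityCGF w μ L s * L * φ η := by
  have hb : 0 < μ * (μ + 2 * w * Real.exp s) := by positivity
  set b := Real.sqrt (μ * (μ + 2 * w * Real.exp s))
  have hb₀ : 0 < b := Real.sqrt_pos.mpr hb
  obtain ⟨φ, hφpos, hφ⟩ := exists_pos_xyHamiltonian_eigenfunction hL hw
    (by positivity : 0 < μ + w * Real.exp s) hb₀
  -- Conjugation by `√(b / μ) ^ particleNumber` gives creation and removal of pairs equal rates.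
  have hg : μ * Real.sqrt (b / μ) ^ 2 = b := by
    rw [Real.sq_sqrt (by positivity), mul_div_cancel₀ _ hμ.ne']
  have hg' : b * Real.sqrt (b / μ) ^ 2 = μ + 2 * w * Real.exp s := by
    rw [Real.sq_sqrt (by positivity), ← mul_div_assoc, ← sq, Real.sq_sqrt hb.le,
      mul_div_cancel_left₀ _ hμ.ne']
  refine ⟨fun η => Real.sqrt (b / μ) ^ particleNumber η * φ η, fun η hη => ?_, fun η => ?_⟩
  · have := hφpos η (by rw [jwSign_eq_neg_one_pow_particleNumber, hη.neg_one_pow])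
    positivity
  · rw [tiltedGenerator_pow_particleNumber_mul hL hg hg', hφ, activityCGF_eq hμ.le hw,
      div_mul_cancel₀ _ (Nat.cast_ne_zero.mpr (NeZero.ne L))]
    ring

lemma isEvenCGF_activityCGF (hL : 2 ≤ L) (hμ : 0 < μ) (hw : 0 ≤ w) :
    IsEvenCGF w μ L (activityCGF w μ L) := by
  intro η hη s
  refine ⟨fun t ht => summable_exp_mul_transitionProb hw hμ.le s ht.le _, ?_⟩
  obtain ⟨φ, hφpos, hφ⟩ := exists_pos_tiltedGenerator_eigenfunction hL hμ hw s
  have hlim := tendsto_log_activityMGF hw hμ.le (S := {ξ : Config L | Even (particleNumber ξ)})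
    (fun ξ hξ k => even_particleNumber_flip hL hξ k) hφpos (fun ξ _ => hφ ξ) hη
  rwa [mul_div_cancel_right₀ _ (Nat.cast_ne_zero.mpr (NeZero.ne L))] at hlim

end CumulantGeneratingFunction

section CriticalAsymptotics

/-! ### Finite-size expansion at the critical point -/

variable {ν : ℝ}

/-- The contribution of the half momentum `θ` to the mean activity at the critical point, up to
the factor `ν / (2 L)`. -/
def criticalDensity (ν θ : ℝ) : ℝ :=
  Real.sin θ * ((1 - 2 * ν * Real.cos θ ^ 2) / Real.sqrt (1 - ν ^ 2 * Real.cos θ ^ 2))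

/-- A primitive of the critical density, obtained by the substitution `y = ν cos θ`. -/
def criticalPrimitive (ν θ : ℝ) : ℝ :=
  (1 - ν) / ν ^ 2 * Real.arcsin (ν * Real.cos θ)
    - Real.cos θ * Real.sqrt (1 - ν ^ 2 * Real.cos θ ^ 2) / ν

lemma one_sub_sq_mul_cos_sq_pos (hν : |ν| < 1) (θ : ℝ) : 0 < 1 - ν ^ 2 * Real.cos θ ^ 2 := by
  have hsq : ν ^ 2 < 1 := (sq_lt_one_iff_abs_lt_one ν).mpr hν
  nlinarith [Real.cos_sq_le_one θ, sq_nonneg ν]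

lemma contDiff_criticalDensity_div_sin (hν : |ν| < 1) {n : ℕ∞} : ContDiff ℝ n fun θ : ℝ =>
    (1 - 2 * ν * Real.cos θ ^ 2) / Real.sqrt (1 - ν ^ 2 * Real.cos θ ^ 2) := by
  have hpos := one_sub_sq_mul_cos_sq_pos hν
  have := Real.contDiff_cos (n := n)
  exact ContDiff.div (by fun_prop) (ContDiff.sqrt (by fun_prop) fun θ => (hpos θ).ne')
    fun θ => (Real.sqrt_pos.mpr (hpos θ)).ne'

lemma contDiff_criticalDensity (hν : |ν| < 1) {n : ℕ∞} : ContDiff ℝ n (criticalDensity ν) :=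
  Real.contDiff_sin.mul (contDiff_criticalDensity_div_sin hν)

lemma deriv_criticalDensity (hν : |ν| < 1) {θ : ℝ} (hθ : Real.sin θ = 0) :
    deriv (criticalDensity ν) θ = Real.cos θ * ((1 - 2 * ν) / Real.sqrt (1 - ν ^ 2)) := by
  have hfactor := ((contDiff_criticalDensity_div_sin hν (n := 1)).differentiable one_ne_zero) θ
  have hderiv := ((Real.hasDerivAt_sin θ).mul hfactor.hasDerivAt).deriv
  have hcos : Real.cos θ ^ 2 = 1 := by rw [Real.cos_sq', hθ]; ring
  rw [hθ, zero_mul, add_zero, hcos, mul_one, mul_one] at hderiv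
  exact hderiv

lemma hasDerivAt_criticalPrimitive (hν₀ : ν ≠ 0) (hν : |ν| < 1) (θ : ℝ) :
    HasDerivAt (criticalPrimitive ν) (criticalDensity ν θ) θ := by
  have hpos := one_sub_sq_mul_cos_sq_pos hν θ
  have hcos := Real.hasDerivAt_cos θ
  have hsq : (ν * Real.cos θ) ^ 2 < 1 := by rw [mul_pow]; linarith
  have habs := abs_lt.mp ((sq_lt_one_iff_abs_lt_one _).mp hsq)
  have harcsin := (Real.hasDerivAt_arcsin habs.1.ne' habs.2.ne).comp θ (hcos.const_mul ν)
  have hsqrt := (((hcos.pow 2).const_mul (ν ^ 2)).const_sub 1).sqrt hpos.ne'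
  refine ((harcsin.const_mul ((1 - ν) / ν ^ 2)).sub
    ((hcos.mul hsqrt).div_const ν)).congr_deriv ?_
  have hR := Real.sq_sqrt hpos.le
  have hR₀ := Real.sqrt_pos.mpr hpos
  simp only [criticalDensity, mul_pow, Pi.pow_apply]
  set R := Real.sqrt (1 - ν ^ 2 * Real.cos θ ^ 2)
  field_simp
  push_cast
  rw [hR]
  ring

lemma integral_criticalDensity (hν : |ν| < 1) :
    ν / (2 * Real.pi) * ∫ θ in 0..Real.pi, criticalDensity ν θ = kappaStarOne ν := by
  rcases eq_or_ne ν 0 with rfl | hν₀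
  · rw [kappaStarOne, if_pos rfl, zero_div, zero_mul]
  · rw [intervalIntegral.integral_eq_sub_of_hasDerivAt
      (fun θ _ => hasDerivAt_criticalPrimitive hν₀ hν θ)
      ((contDiff_criticalDensity hν (n := 0)).continuous.intervalIntegrable _ _), kappaStarOne,
      if_neg hν₀, criticalPrimitive, criticalPrimitive, Real.cos_pi, Real.cos_zero, mul_neg_one,
      Real.arcsin_neg, mul_one, neg_one_sq, one_pow, mul_one]
    field_simp
    ring

lemma dispersionSq_critical (ν θ : ℝ) : dispersionSq (1 / 2) ((1 - ν) / 2) ν (2 * θ) =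
    Real.sin θ ^ 2 * (1 - ν ^ 2 * Real.cos θ ^ 2) := by
  rw [dispersionSq, Real.cos_two_mul, Real.sin_sq]
  ring

lemma meanActivity_critical (hν : |ν| < 1) (L : ℕ) :
    meanActivity (1 / 2) ((1 - ν) / 2) L ν = ν / (2 * L) *
      ∑ j ∈ Finset.range L, criticalDensity ν (Real.pi * (2 * j + 1) / (2 * L)) := by
  rw [meanActivity, Finset.mul_sum, Finset.mul_sum]
  refine Finset.sum_congr rfl fun j hj => ?_
  have hjL : (j : ℝ) + 1 ≤ L := by exact_mod_cast Finset.mem_range.mp hj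
  have hL : (0 : ℝ) < L := by linarith [(Nat.cast_nonneg j : (0 : ℝ) ≤ j)]
  set θ := Real.pi * (2 * j + 1) / (2 * L) with hθ
  have hmomentum : momentum L j = 2 * θ := by
    rw [momentum, hθ]
    field_simp
  have hsin : 0 < Real.sin θ := by
    refine Real.sin_pos_of_pos_of_lt_pi (by positivity) ?_
    rw [hθ, div_lt_iff₀ (by positivity)]
    nlinarith [Real.pi_pos]
  have hR := Real.sqrt_pos.mpr (one_sub_sq_mul_cos_sq_pos hν θ)
  rw [hmomentum, dispersionSq_critical, Real.sqrt_mul (sq_nonneg _), Real.sqrt_sq hsin.le,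
    Real.cos_two_mul, criticalDensity]
  field_simp
  rw [Real.sin_sq]
  ring

lemma isBigO_meanActivity_critical (hν : |ν| < 1) :
    (fun L : ℕ => meanActivity (1 / 2) ((1 - ν) / 2) L ν - (kappaStarOne ν
      + ν * (1 - 2 * ν) / Real.sqrt (1 - ν ^ 2) * (Real.pi / (24 * (L : ℝ) ^ 2))))
      =O[atTop] fun L : ℕ => 1 / (L : ℝ) ^ 4 := by
  have hpi := Real.pi_pos
  refine ((isBigO_midpoint_sum_sub_integral (contDiff_criticalDensity hν) hpi.le).const_mul_left
    (ν / (2 * Real.pi))).congr_left fun L => ?_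
  rw [meanActivity_critical hν, ← integral_criticalDensity hν,
    deriv_criticalDensity hν Real.sin_pi, deriv_criticalDensity hν Real.sin_zero, Real.cos_pi,
    Real.cos_zero]
  simp only [sub_zero, zero_add]
  field_simp
  ring

end CriticalAsymptotics

end DLPAD

end

theorem mainTheorem4 (ν : ℝ) (hν0 : 0 ≤ ν) (hν1 : ν < 1) :
    ∃ (K A : ℕ → ℝ → ℝ) (Ac : ℕ → ℝ),
      -- `K L` is the limiting cumulant generating function, `A L` the mean activity
      (∀ (L : ℕ) [NeZero L], 2 ≤ L →
        DLPAD.IsEvenCGF (1 / 2) ((1 - ν) / 2) L (K L) ∧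
        ∀ s : ℝ, HasDerivAt (K L) (A L s) s) ∧
      -- `Ac L` is the mean activity at the critical point, which is `-∞` for `ν = 0`
      (0 < ν → ∀ L : ℕ, 2 ≤ L → Ac L = A L (DLPAD.criticalPoint (1 / 2) ((1 - ν) / 2))) ∧
      (ν = 0 → ∀ L : ℕ, 2 ≤ L → Tendsto (A L) atBot (𝓝 (Ac L))) ∧
      (fun L : ℕ => Ac L - (DLPAD.kappaStarOne ν
          + ν * (1 - 2 * ν) / Real.sqrt (1 - ν ^ 2) * (Real.pi / (24 * (L : ℝ) ^ 2))))
        =O[atTop] fun L : ℕ => 1 / (L : ℝ) ^ 4 := by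
  have hw : (0 : ℝ) ≤ 1 / 2 := by norm_num
  have hμ : 0 < (1 - ν) / 2 := by linarith
  refine ⟨DLPAD.activityCGF (1 / 2) ((1 - ν) / 2),
    fun L s => DLPAD.meanActivity (1 / 2) ((1 - ν) / 2) L (Real.exp s),
    fun L => DLPAD.meanActivity (1 / 2) ((1 - ν) / 2) L ν, fun L _ hL =>
      ⟨DLPAD.isEvenCGF_activityCGF hL hμ hw, DLPAD.hasDerivAt_activityCGF hμ hw⟩,
    fun hν L _ => ?_, fun hν L hL => ?_,
    DLPAD.isBigO_meanActivity_critical (abs_lt.mpr ⟨by linarith, hν1⟩)⟩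
  · have hcritical : 1 - (1 - ν) / 2 / (1 / 2) = ν := by ring
    simp only [DLPAD.criticalPoint, hcritical, Real.exp_log hν]
  · have : NeZero L := ⟨by omega⟩
    subst hν
    exact DLPAD.tendsto_meanActivity_atBot hμ hw
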